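/- Let $F$ be a field and let $\Gamma=(V,E)$ be a row-finite directed graph (every vertex emits only finitely many edges; loops and multiple edges are allowed), with source and range maps $s,r:E\to V$. A vertex is a sink if it emits no edge. For $X,Y\subseteq V$ put $E(X,Y)=\{e\in E: s(e)\in X,\ r(e)\in Y\}$. All algebras are associative $F$-algebras that need not have a unit, and ideals are two-sided ideals of $F$-algebras. *Cohn and Leavitt path algebras.* The Cohn algebra $C(\Gamma)$ is presented by the generators $V\sqcup E\sqcup E^*$ and the relations $v^2=v$; $vw=0$ for $v\ne w$; $s(e)e=e\,r(e)=e$; $e^*s(e)=r(e)e^*=e^*$; $e^*f=0$ for $e\neq f$; $e^*e=r(e)$. For a nonsink $v$ put $CK(v)'=v-\sum_{s(f)=v}ff^*$. The Leavitt path algebra $L(\Gamma)$ is the quotient of $C(\Gamma)$ by the ideal generated by all $CK(v)'$, $v$ a nonsink. *Wreath products.* Let $A$ be an algebra, $\mathcal E$ a family of pairwise orthogonal idempotents of $A$, and $E(V,\mathcal E)$ a set of additional edges, each with a source in $V$ and a range in $\mathcal E$, such that each vertex emits only finitely many of them and sinks of $\Gamma$ emit none. Let $\mathcal P$ consist of a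 zero element $0$ and of all $pe$, where $p$ is a path in $\Gamma$ (possibly of length $0$) and $e\in E(V,\mathcal E)$ starts at the end of $p$. The generators of $C(\Gamma)$ act on $\mathcal P$ on the left by multiplication in the Cohn algebra of the graph $\Gamma$ extended by the vertices $\mathcal E$ and the edges $E(V,\mathcal E)$: for $x\in\mathcal P\setminus\{0\}$ with start $s(x)$, $vx=x$ if $s(x)=v$; $fx$ is the path $x$ preceded by $f$ if $r(f)=s(x)$; $f^*x=y$ if $x=fy$; in all other cases, and on $0$, the result is $0$. They act on the right by $xg=g^*x$ (with $v^*=v$, $(f^*)^*=f$). Let $M_{\mathcal P\times\mathcal P}(A)$ be the algebra of $\mathcal P\times\mathcal P$ matrices over $A$ with finitely many nonzero entries, and let $a_{x,y}$ be the matrix with the entry $a$ in position $(x,y)$ and zeros elsewhere. The space $C(\Gamma)\oplus M_{\mathcal P\times\mathcal P}(A)$ is an associative algebra, where for generators $g$ of $C(\Gamma)$ one has $g\,a_{x,y}=a_{gx,y}$ if $gx\ne0$, $g\,a_{x,y}=0$ if $gx=0$, $a_{x,y}\,g=a_{x,yg}$ if $yg\neq 0$, and $a_{x,y}\,g=0$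 if $yg=0$. Let $r(x)\in\mathcal E$ be the end of $x\in\mathcal P\setminus\{0\}$ and let $r(0)=1$ be a formal unit. Let $I$ be the set of the matrices whose $(x,y)$-entry lies in $r(x)Ar(y)$ for all $x,y\in\mathcal P$; then $C(\Gamma)+I$ is a subalgebra. The wreath product $A\,\mathrm{wr}\,L(\Gamma)$ is the quotient of $C(\Gamma)+I$ by the ideal generated by the elements $$CK(v)=v-\sum_{f\in E,\ s(f)=v}ff^*-\sum_{e\in E(V,\mathcal E),\ s(e)=v} r(e)_{e,e},\qquad v\in V \text{ a nonsink of }\Gamma .$$ **Proposition 2.** Let $W\subseteq V$ be hereditary (if $s(e)\in W$ then $r(e)\in W$) and saturated (a nonsink all of whose edges have their range in $W$ lies in $W$). Let $\Gamma(W)=(W,E(W,W))$, and let $\Gamma/W$ be the graph with the vertices $V\setminus W$ and the edges $E\setminus E(V,W)$. Then there is an isomorphism of $F$-algebras $$L(\Gamma)\;\cong\;L(\Gamma(W))\ \mathrm{wr}\ L(\Gamma/W),$$ where the wreath product is formed with the algebra $A=L(\Gamma(W))$, the graph $\Gamma/W$, the family of idempotents $\mathcal E=W$ (the vertices of $\Gamma(W)$,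 as elements of $A$), and the connecting edges $E(V\setminus W,W)$. -/

import Mathlib

set_option linter.unusedSectionVars false

noncomputable section

universe u v w x y z

/-! ### Quotients of (not necessarily unital) algebras by generated ideals -/

section Quotients

variable (F : Type u) [Field F] {R : Type v} [NonUnitalRing R] [Module F R]

/-- The (two-sided, `F`-stable) ideal of the `F`-algebra `R` generated by a set `s`. -/
def genIdeal (s : Set R) : Submodule F R :=
  sInf {N | s ⊆ (N : Set R) ∧ ∀ r : R, ∀ n ∈ N, r * n ∈ N ∧ n * r ∈ N}

theorem subset_genIdeal {s : Set R} {a : R} (ha : a ∈ s) : a ∈ genIdeal F s :=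
  Submodule.mem_sInf.2 fun _ hN => hN.1 ha

theorem mul_mem_genIdeal {s : Set R} (r : R) {n : R} (hn : n ∈ genIdeal F s) :
    r * n ∈ genIdeal F s ∧ n * r ∈ genIdeal F s :=
  ⟨Submodule.mem_sInf.2 fun N hN => (hN.2 r n (Submodule.mem_sInf.1 hn N hN)).1,
    Submodule.mem_sInf.2 fun N hN => (hN.2 r n (Submodule.mem_sInf.1 hn N hN)).2⟩

/-- The quotient of the `F`-algebra `R` by the ideal generated by `s`. -/
def AlgQuot (s : Set R) : Type v := R ⧸ genIdeal F s

namespace AlgQuot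

variable {F} (s : Set R)

instance : AddCommGroup (AlgQuot F s) := inferInstanceAs (AddCommGroup (R ⧸ genIdeal F s))

instance : Module F (AlgQuot F s) := inferInstanceAs (Module F (R ⧸ genIdeal F s))

/-- The quotient map, as a linear map. -/
def proj : R →ₗ[F] AlgQuot F s := (genIdeal F s).mkQ

theorem proj_surjective : Function.Surjective (proj (F := F) s) :=
  Submodule.mkQ_surjective _

theorem proj_eq_iff {a b : R} : proj (F := F) s a = proj s b ↔ a - b ∈ genIdeal F s :=
  Submodule.Quotient.eq _

instance : Mul (AlgQuot F s) where
  mul a b := Quotient.liftOn₂' a b (fun a b => proj (F := F) s (a * b)) (by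
    intro a₁ b₁ a₂ b₂ h₁ h₂
    rw [Submodule.quotientRel_def] at h₁ h₂
    rw [proj_eq_iff]
    have : a₁ * b₁ - a₂ * b₂ = (a₁ - a₂) * b₁ + a₂ * (b₁ - b₂) := by
      rw [sub_mul, mul_sub]; abel
    rw [this]
    exact add_mem (mul_mem_genIdeal F b₁ h₁).2 (mul_mem_genIdeal F a₂ h₂).1)

theorem proj_mul (a b : R) : proj (F := F) s (a * b) = proj s a * proj s b := rfl

instance : NonUnitalRing (AlgQuot F s) where
  left_distrib a b c := by
    obtain ⟨a, rfl⟩ := proj_surjective s a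
    obtain ⟨b, rfl⟩ := proj_surjective s b
    obtain ⟨c, rfl⟩ := proj_surjective s c
    simp only [← proj_mul, ← map_add, mul_add]
  right_distrib a b c := by
    obtain ⟨a, rfl⟩ := proj_surjective s a
    obtain ⟨b, rfl⟩ := proj_surjective s b
    obtain ⟨c, rfl⟩ := proj_surjective s c
    simp only [← proj_mul, ← map_add, add_mul]
  zero_mul a := by
    obtain ⟨a, rfl⟩ := proj_surjective s a
    rw [← map_zero (proj s), ← proj_mul, zero_mul]
  mul_zero a := by
    obtain ⟨a, rfl⟩ := proj_surjective s a
    rw [← map_zero (proj s), ← proj_mul, mul_zero]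
  mul_assoc a b c := by
    obtain ⟨a, rfl⟩ := proj_surjective s a
    obtain ⟨b, rfl⟩ := proj_surjective s b
    obtain ⟨c, rfl⟩ := proj_surjective s c
    simp only [← proj_mul, mul_assoc]

instance [IsScalarTower F R R] : IsScalarTower F (AlgQuot F s) (AlgQuot F s) where
  smul_assoc t a b := by
    obtain ⟨a, rfl⟩ := proj_surjective s a
    obtain ⟨b, rfl⟩ := proj_surjective s b
    simp only [smul_eq_mul, ← map_smul, ← proj_mul, smul_mul_assoc]

instance [SMulCommClass F R R] : SMulCommClass F (AlgQuot F s) (AlgQuot F s) where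
  smul_comm t a b := by
    obtain ⟨a, rfl⟩ := proj_surjective s a
    obtain ⟨b, rfl⟩ := proj_surjective s b
    simp only [smul_eq_mul, ← map_smul, ← proj_mul, mul_smul_comm]

/-- The quotient map, as a homomorphism of algebras. -/
def mk : R →ₙₐ[F] AlgQuot F s where
  toFun := proj s
  map_smul' := map_smul (proj s)
  map_zero' := map_zero (proj s)
  map_add' := map_add (proj s)
  map_mul' := proj_mul s

theorem mk_surjective : Function.Surjective (mk (F := F) s) := proj_surjective s

theorem mk_eq_zero {a : R} (ha : a ∈ s) : mk (F := F) s a = 0 :=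
  (Submodule.Quotient.mk_eq_zero _).2 (subset_genIdeal F ha)

variable {B : Type w} [NonUnitalRing B] [Module F B]

theorem genIdeal_le_ker (f : R →ₙₐ[F] B) (h : ∀ a ∈ s, f a = 0) :
    genIdeal F s ≤ LinearMap.ker (f : R →ₗ[F] B) :=
  sInf_le ⟨fun a ha => h a ha, fun r n hn => by
    have hn' : f n = 0 := hn
    constructor
    · change f (r * n) = 0
      rw [map_mul, hn', mul_zero]
    · change f (n * r) = 0
      rw [map_mul, hn', zero_mul]⟩

/-- The universal property of the quotient. -/
def lift (f : R →ₙₐ[F] B) (h : ∀ a ∈ s, f a = 0) : AlgQuot F s →ₙₐ[F] B where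
  toFun := (genIdeal F s).liftQ (f : R →ₗ[F] B) (genIdeal_le_ker s f h)
  map_smul' := map_smul ((genIdeal F s).liftQ (f : R →ₗ[F] B) (genIdeal_le_ker s f h))
  map_zero' := map_zero ((genIdeal F s).liftQ (f : R →ₗ[F] B) (genIdeal_le_ker s f h))
  map_add' := map_add ((genIdeal F s).liftQ (f : R →ₗ[F] B) (genIdeal_le_ker s f h))
  map_mul' a b := by
    obtain ⟨a, rfl⟩ := proj_surjective s a
    obtain ⟨b, rfl⟩ := proj_surjective s b
    exact map_mul f a b

@[simp] theorem lift_mk (f : R →ₙₐ[F] B) (h : ∀ a ∈ s, f a = 0) (a : R) :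
    lift s f h (mk s a) = f a := rfl

end AlgQuot

end Quotients

/-! ### Graphs -/

/-- A row-finite directed graph (loops and multiple edges allowed) with vertex set `V`
and edge set `E`. -/
structure RFGraph (V : Type v) (E : Type w) where
  /-- source -/
  s : E → V
  /-- range -/
  r : E → V
  finite_out : ∀ a : V, {e : E | s e = a}.Finite

namespace RFGraph

section Basic

variable {V : Type v} {E : Type w} (Γ : RFGraph V E)

/-- The finite set `s⁻¹(a)` of edges with source `a`. -/
def out (a : V) : Finset E := (Γ.finite_out a).toFinset

/-- A sink is a vertex that emits no edges. -/
def IsSink (a : V) : Prop := ∀ e : E, Γ.s e ≠ a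

/-- `W` is hereditary: edges that start in `W` end in `W`. -/
def Hereditary (W : Set V) : Prop := ∀ e : E, Γ.s e ∈ W → Γ.r e ∈ W

/-- `W` is saturated: a nonsink all of whose edges end in `W` belongs to `W`. -/
def Saturated (W : Set V) : Prop :=
  ∀ a : V, ¬ Γ.IsSink a → (∀ e : E, Γ.s e = a → Γ.r e ∈ W) → a ∈ W

/-- The restriction `Γ(W) = (W, E(W,W))`. -/
def restrict (W : Set V) : RFGraph W {e : E // Γ.s e ∈ W ∧ Γ.r e ∈ W} where
  s e := ⟨Γ.s e.1, e.2.1⟩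
  r e := ⟨Γ.r e.1, e.2.2⟩
  finite_out a :=
    Set.Finite.subset ((Γ.finite_out a.1).preimage Subtype.val_injective.injOn)
      fun _ he => congrArg Subtype.val he

variable {Γ} in
/-- The quotient graph `Γ/W = (V \ W, E \ E(V,W))` by a hereditary set `W`. -/
def quotient {W : Set V} (hW : Γ.Hereditary W) :
    RFGraph {a : V // a ∉ W} {e : E // Γ.r e ∉ W} where
  s e := ⟨Γ.s e.1, fun h => e.2 (hW e.1 h)⟩
  r e := ⟨Γ.r e.1, e.2⟩
  finite_out a :=
    Set.Finite.subset ((Γ.finite_out a.1).preimage Subtype.val_injective.injOn)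
      fun _ he => congrArg Subtype.val he

/-- `Γ.IsPath a p b`: the list of edges `p` is a path in `Γ` that starts at `a` and ends at `b`
(the empty list gives the path of length `0` at a vertex). -/
def IsPath : V → List E → V → Prop
  | a, [], b => a = b
  | a, e :: p, b => Γ.s e = a ∧ IsPath (Γ.r e) p b

end Basic

/-! ### Cohn algebras and Leavitt path algebras -/

/-- The generators `V ∪ E ∪ E*` of the Cohn algebra. -/
inductive Gen (V : Type v) (E : Type w) : Type (max v w)
  | vert (a : V)
  | edge (e : E)
  | ghost (e : E)

section Cohn

variable (F : Type u) [Field F] {V : Type v} {E : Type w}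

/-- The free associative algebra without unit on the generators `V ∪ E ∪ E*`. -/
abbrev FreeGen (V : Type v) (E : Type w) : Type (max u v w) :=
  MonoidAlgebra F (FreeSemigroup (Gen V E))

/-- A generator, as an element of the free algebra. -/
def FreeGen.of (g : Gen V E) : FreeGen F V E := MonoidAlgebra.single (FreeSemigroup.of g) 1

variable (Γ : RFGraph V E)

open Gen FreeGen in
/-- The relators of the Cohn algebra. -/
inductive CohnRel : FreeGen F V E → Prop
  | idem (a : V) : CohnRel (of F (vert a) * of F (vert a) - of F (vert a))
  | orth (a b : V) (h : a ≠ b) : CohnRel (of F (vert a) * of F (vert b))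
  | source_mul (e : E) : CohnRel (of F (vert (Γ.s e)) * of F (edge e) - of F (edge e))
  | mul_range (e : E) : CohnRel (of F (edge e) * of F (vert (Γ.r e)) - of F (edge e))
  | ghost_source (e : E) : CohnRel (of F (ghost e) * of F (vert (Γ.s e)) - of F (ghost e))
  | range_ghost (e : E) : CohnRel (of F (vert (Γ.r e)) * of F (ghost e) - of F (ghost e))
  | ghost_ne (e f : E) (h : e ≠ f) : CohnRel (of F (ghost e) * of F (edge f))
  | ghost_self (e : E) : CohnRel (of F (ghost e) * of F (edge e) - of F (vert (Γ.r e)))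

/-- The Cohn algebra `C(Γ)` over `F`, presented by generators and relations
(as an algebra that need not have a unit). -/
abbrev Cohn : Type (max u v w) := AlgQuot F {t : FreeGen F V E | CohnRel F Γ t}

namespace Cohn

/-- A generator, as an element of the Cohn algebra. -/
def of (g : Gen V E) : Cohn F Γ := AlgQuot.mk _ (FreeGen.of F g)

variable {F}

section lift

variable {B : Type x} [NonUnitalRing B] [Module F B] [IsScalarTower F B B] [SMulCommClass F B B]

/-- The homomorphism from the free algebra given by the images of the generators. -/
def freeLift (φ : Gen V E → B) : FreeGen F V E →ₙₐ[F] B :=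
  MonoidAlgebra.liftMagma F (FreeSemigroup.lift φ)

theorem freeLift_of (φ : Gen V E → B) (g : Gen V E) :
    freeLift φ (FreeGen.of F g) = φ g := by
  simp [freeLift, FreeGen.of]

/-- The homomorphism from the Cohn algebra given by images of the generators that satisfy the
relations. -/
def lift (φ : Gen V E → B) (h : ∀ t, CohnRel F Γ t → freeLift φ t = 0) : Cohn F Γ →ₙₐ[F] B :=
  AlgQuot.lift _ (freeLift φ) h

theorem lift_of (φ : Gen V E → B) (h : ∀ t, CohnRel F Γ t → freeLift φ t = 0) (g : Gen V E) :
    lift Γ φ h (of F Γ g) = φ g := freeLift_of φ g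

end lift

theorem induction {motive : Cohn F Γ → Prop} (c : Cohn F Γ)
    (gen : ∀ g, motive (of F Γ g)) (zero : motive 0)
    (add : ∀ a b, motive a → motive b → motive (a + b))
    (mul : ∀ a b, motive a → motive b → motive (a * b))
    (smul : ∀ (t : F) a, motive a → motive (t • a)) : motive c := by
  obtain ⟨c, rfl⟩ := AlgQuot.mk_surjective _ c
  induction c using MonoidAlgebra.induction_linear with
  | zero => rwa [map_zero]
  | add a b ha hb => rw [map_add]; exact add _ _ ha hb
  | single m t =>
    have : (MonoidAlgebra.single m t : FreeGen F V E) = t • MonoidAlgebra.single m 1 := by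
      simp
    rw [this, map_smul]
    apply smul
    induction m using FreeSemigroup.recOnMul with
    | ih1 g => exact gen g
    | ih2 g m hg hm =>
      have : (MonoidAlgebra.single (FreeSemigroup.of g * m) 1 : FreeGen F V E)
          = MonoidAlgebra.single (FreeSemigroup.of g) 1 * MonoidAlgebra.single m 1 := by
        simp [MonoidAlgebra.single_mul_single]
      rw [this, map_mul]
      exact mul _ _ (gen g) (hm (by simp))

end Cohn

/-- The element `CK(a)' = a - ∑_{s(f) = a} f f*` of the Cohn algebra. -/
def ck (a : V) : Cohn F Γ :=
  Cohn.of F Γ (.vert a) - ∑ f ∈ Γ.out a, Cohn.of F Γ (.edge f) * Cohn.of F Γ (.ghost f)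

/-- The Leavitt path algebra `L(Γ)` over `F`: the quotient of the Cohn algebra by the ideal
generated by the elements `CK(a)'`, where `a` runs over the nonsink vertices. -/
abbrev Leavitt : Type (max u v w) :=
  AlgQuot F {c : Cohn F Γ | ∃ a : V, ¬ Γ.IsSink a ∧ c = ck F Γ a}

/-- The image in the Leavitt path algebra of a generator. -/
def Leavitt.of (g : Gen V E) : Leavitt F Γ := AlgQuot.mk _ (Cohn.of F Γ g)

end Cohn

end RFGraph

/-! ### Matrices with finitely many nonzero entries -/

/-- The `X × X` matrices over `A` with only finitely many nonzero entries. -/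
def FinMat (X : Type x) (A : Type y) [Zero A] : Type (max x y) := X × X →₀ A

namespace FinMat

variable {F : Type u} [Field F] {X : Type x} {A : Type y}
  [NonUnitalRing A] [Module F A]

instance : AddCommGroup (FinMat X A) := inferInstanceAs (AddCommGroup (X × X →₀ A))

instance : Module F (FinMat X A) := inferInstanceAs (Module F (X × X →₀ A))

/-- A matrix, as a finitely supported function. -/
def toFinsupp (m : FinMat X A) : X × X →₀ A := m

/-- The entry of a matrix in row `p` and column `q`. -/
def entry (m : FinMat X A) (p q : X) : A := toFinsupp m (p, q)

/-- The matrix `a_{p,q}` with entry `a` in row `p`, column `q` and zeros elsewhere. -/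
def unit (p q : X) (a : A) : FinMat X A := (Finsupp.single (p, q) a : X × X →₀ A)

@[elab_as_elim]
theorem induction {motive : FinMat X A → Prop} (m : FinMat X A) (zero : motive 0)
    (add : ∀ m n, motive m → motive n → motive (m + n))
    (unit : ∀ p q a, motive (unit p q a)) : motive m :=
  Finsupp.induction_linear (motive := motive) m zero (fun m n => add m n)
    (fun i a => unit i.1 i.2 a)

theorem linearMap_ext {B : Type z} [AddCommGroup B] [Module F B] {f g : FinMat X A →ₗ[F] B}
    (h : ∀ p q a, f (unit p q a) = g (unit p q a)) : f = g := by
  ext m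
  induction m using FinMat.induction with
  | zero => rw [map_zero, map_zero]
  | add m n hm hn => rw [map_add, map_add, hm, hn]
  | unit p q a => exact h p q a

/-- `a ↦ a_{p,q}` as a linear map. -/
def unitLin (F : Type u) [Field F] [Module F A] (p q : X) : A →ₗ[F] FinMat X A where
  toFun := unit p q
  map_add' a b := Finsupp.single_add _ a b
  map_smul' t a := (Finsupp.smul_single t _ a).symm

/-- The linear map on matrices with given values on the matrices `a_{p,q}`. -/
def extend {B : Type z} [AddCommGroup B] [Module F B] (φ : X × X → A →ₗ[F] B) :
    FinMat X A →ₗ[F] B where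
  toFun m := Finsupp.lsum F φ (toFinsupp m)
  map_add' m n := map_add (Finsupp.lsum F φ) (toFinsupp m) (toFinsupp n)
  map_smul' t m := map_smul (Finsupp.lsum F φ) t (toFinsupp m)

theorem extend_unit {B : Type z} [AddCommGroup B] [Module F B] (φ : X × X → A →ₗ[F] B)
    (p q : X) (a : A) : extend φ (unit p q a) = φ (p, q) a :=
  Finsupp.lsum_single F φ (p, q) a

theorem extend_mem {B : Type z} [AddCommGroup B] [Module F B] (φ : X × X → A →ₗ[F] B)
    (m : FinMat X A) (N : Submodule F B) (h : ∀ p q, φ (p, q) (entry m p q) ∈ N) :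
    extend φ m ∈ N :=
  Submodule.sum_mem _ fun i _ => h i.1 i.2

theorem unit_zero (p q : X) : unit p q (0 : A) = 0 := Finsupp.single_zero _

theorem unit_add (p q : X) (a b : A) : unit p q (a + b) = unit p q a + unit p q b :=
  Finsupp.single_add _ _ _

theorem smul_unit (t : F) (p q : X) (a : A) : t • unit p q a = unit p q (t • a) :=
  Finsupp.smul_single _ _ _

open Classical in
theorem entry_unit (p q p' q' : X) (a : A) :
    entry (unit p q a) p' q' = if p = p' ∧ q = q' then a else 0 := by
  refine (Finsupp.single_apply (a := (p, q)) (a' := (p', q'))).trans ?_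
  simp only [Prod.mk.injEq]

theorem entry_add (m n : FinMat X A) (p q : X) :
    entry (m + n) p q = entry m p q + entry n p q := rfl

theorem entry_smul (t : F) (m : FinMat X A) (p q : X) : entry (t • m) p q = t • entry m p q := rfl

theorem entry_zero (p q : X) : entry (0 : FinMat X A) p q = 0 := rfl

open Classical in
/-- Matrix multiplication: the additive extension of `a_{p,q} b_{q,t} = (ab)_{p,t}` and
`a_{p,q} b_{q',t} = 0` for `q ≠ q'`. -/
instance : Mul (FinMat X A) where
  mul m n :=
    Finsupp.sum (toFinsupp m) fun i a =>
      Finsupp.sum (toFinsupp n) fun j b =>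
        if i.2 = j.1 then unit i.1 j.2 (a * b) else 0

open Classical in
theorem mul_def (m n : FinMat X A) : m * n =
    Finsupp.sum (toFinsupp m) fun i a =>
      Finsupp.sum (toFinsupp n) fun j b =>
        if i.2 = j.1 then unit i.1 j.2 (a * b) else 0 := rfl

theorem fm_mul_mem (m n : FinMat X A) (N : Submodule F (FinMat X A))
    (h : ∀ p q t, unit p t (entry m p q * entry n q t) ∈ N) : m * n ∈ N := by
  classical
  rw [mul_def]
  refine Submodule.sum_mem _ fun i _ => Submodule.sum_mem _ fun j _ => ?_
  obtain ⟨p, q⟩ := i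
  obtain ⟨q', t⟩ := j
  by_cases hq : q = q'
  · subst hq
    simpa [entry] using h p q t
  · simp [hq]

theorem fm_zero_mul (m : FinMat X A) : 0 * m = 0 := Finsupp.sum_zero_index

theorem fm_mul_zero (m : FinMat X A) : m * 0 = 0 := by
  rw [mul_def]
  refine (Finsupp.sum_congr (g2 := fun _ _ => 0) fun i _ => ?_).trans (Finsupp.sum_fun_zero _)
  exact Finsupp.sum_zero_index

theorem fm_add_mul (m m' n : FinMat X A) : (m + m') * n = m * n + m' * n := by
  classical
  rw [mul_def, mul_def, mul_def]
  refine Finsupp.sum_add_index' (fun i => ?_) (fun i a b => ?_)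
  · refine (Finsupp.sum_congr fun j _ => ?_).trans (Finsupp.sum_fun_zero _)
    simp only [zero_mul, unit_zero, ite_self]
  · rw [← Finsupp.sum_add]
    refine Finsupp.sum_congr fun j _ => ?_
    split_ifs
    · rw [add_mul, unit_add]
    · rw [add_zero]

theorem fm_mul_add (m n n' : FinMat X A) : m * (n + n') = m * n + m * n' := by
  classical
  rw [mul_def, mul_def, mul_def, ← Finsupp.sum_add]
  refine Finsupp.sum_congr fun i _ => ?_
  refine Finsupp.sum_add_index' (fun j => ?_) (fun j a b => ?_)
  · simp only [mul_zero, unit_zero, ite_self]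
  · split_ifs
    · rw [mul_add, unit_add]
    · rw [add_zero]

open Classical in
theorem unit_mul_unit (p q q' t : X) (a b : A) :
    unit p q a * unit q' t b = if q = q' then unit p t (a * b) else 0 := by
  rw [mul_def]
  refine (Finsupp.sum_single_index ?_).trans ((Finsupp.sum_single_index ?_).trans rfl)
  · refine (Finsupp.sum_congr fun j _ => ?_).trans (Finsupp.sum_fun_zero _)
    simp only [zero_mul, unit_zero, ite_self]
  · simp only [mul_zero, unit_zero, ite_self]

instance : NonUnitalRing (FinMat X A) where
  left_distrib := fm_mul_add
  right_distrib := fm_add_mul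
  zero_mul := fm_zero_mul
  mul_zero := fm_mul_zero
  mul_assoc m n k := by
    classical
    induction m using FinMat.induction with
    | zero => simp only [fm_zero_mul]
    | add m m' h h' => simp only [fm_add_mul, h, h']
    | unit p q a =>
      induction n using FinMat.induction with
      | zero => simp only [fm_zero_mul, fm_mul_zero]
      | add n n' h h' => simp only [fm_add_mul, fm_mul_add, h, h']
      | unit p' q' b =>
        induction k using FinMat.induction with
        | zero => simp only [fm_mul_zero]
        | add k k' h h' => simp only [fm_mul_add, h, h']
        | unit p'' q'' c =>
          rw [unit_mul_unit, unit_mul_unit]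
          by_cases h₁ : q = p' <;> by_cases h₂ : q' = p'' <;>
            simp [h₁, h₂, unit_mul_unit, fm_zero_mul, fm_mul_zero, mul_assoc]

instance [IsScalarTower F A A] : IsScalarTower F (FinMat X A) (FinMat X A) where
  smul_assoc t m n := by
    classical
    simp only [smul_eq_mul]
    induction m using FinMat.induction with
    | zero => simp only [smul_zero, zero_mul]
    | add m m' h h' => simp only [smul_add, add_mul, h, h']
    | unit p q a =>
      induction n using FinMat.induction with
      | zero => simp only [smul_zero, mul_zero]
      | add n n' h h' => simp only [smul_add, mul_add, h, h']
      | unit p' q' b =>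
        rw [smul_unit, unit_mul_unit, unit_mul_unit]
        split_ifs
        · rw [smul_unit, smul_mul_assoc]
        · rw [smul_zero]

instance [SMulCommClass F A A] : SMulCommClass F (FinMat X A) (FinMat X A) where
  smul_comm t m n := by
    classical
    simp only [smul_eq_mul]
    induction m using FinMat.induction with
    | zero => simp only [smul_zero, zero_mul]
    | add m m' h h' => simp only [smul_add, add_mul, h, h']
    | unit p q a =>
      induction n using FinMat.induction with
      | zero => simp only [smul_zero, mul_zero]
      | add n n' h h' => simp only [smul_add, mul_add, h, h']
      | unit p' q' b =>
        rw [smul_unit, unit_mul_unit, unit_mul_unit]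
        split_ifs
        · rw [smul_unit, mul_smul_comm]
        · rw [smul_zero]

/-! In an index set `Option P` the element `none` plays the part of the zero of the set. -/

variable {P : Type x}

open Classical in
variable (F A) in
/-- The linear map with `a_{p,q} ↦ a_{f p,q}` if `f p` is not zero, and `a_{p,q} ↦ 0` otherwise. -/
def rowMap (f : Option P → Option P) : FinMat (Option P) A →ₗ[F] FinMat (Option P) A :=
  extend fun i => if f i.1 = none then 0 else unitLin F (f i.1) i.2

open Classical in
variable (F A) in
/-- The linear map with `a_{p,q} ↦ a_{p,f q}` if `f q` is not zero, and `a_{p,q} ↦ 0` otherwise. -/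
def colMap (f : Option P → Option P) : FinMat (Option P) A →ₗ[F] FinMat (Option P) A :=
  extend fun i => if f i.2 = none then 0 else unitLin F i.1 (f i.2)

open Classical in
theorem rowMap_unit (f : Option P → Option P) (p q : Option P) (a : A) :
    rowMap F A f (unit p q a) = if f p = none then 0 else unit (f p) q a := by
  refine (extend_unit _ p q a).trans ?_
  by_cases h : f p = none
  · simp only [h, if_true]; rfl
  · simp only [h, if_false]; rfl

open Classical in
theorem colMap_unit (f : Option P → Option P) (p q : Option P) (a : A) :
    colMap F A f (unit p q a) = if f q = none then 0 else unit p (f q) a := by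
  refine (extend_unit _ p q a).trans ?_
  by_cases h : f q = none
  · simp only [h, if_true]; rfl
  · simp only [h, if_false]; rfl

theorem rowMap_mul (f g : Option P → Option P) (hf : f none = none) :
    (rowMap F A f * rowMap F A g : Module.End F (FinMat (Option P) A)) = rowMap F A (f ∘ g) := by
  classical
  refine linearMap_ext fun p q a => ?_
  rw [Module.End.mul_apply, rowMap_unit, rowMap_unit]
  by_cases h : g p = none
  · simp [h, hf]
  · simp [h, rowMap_unit]

theorem colMap_mul (f g : Option P → Option P) (hf : f none = none) :
    (colMap F A f * colMap F A g : Module.End F (FinMat (Option P) A)) = colMap F A (f ∘ g) := by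
  classical
  refine linearMap_ext fun p q a => ?_
  rw [Module.End.mul_apply, colMap_unit, colMap_unit]
  by_cases h : g q = none
  · simp [h, hf]
  · simp [h, colMap_unit]

theorem rowMap_none : rowMap F A (fun _ : Option P => none) = 0 := by
  classical
  exact linearMap_ext fun p q a => by simp [rowMap_unit]

theorem colMap_none : colMap F A (fun _ : Option P => none) = 0 := by
  classical
  exact linearMap_ext fun p q a => by simp [colMap_unit]

theorem rowMap_colMap (f g : Option P → Option P) (m : FinMat (Option P) A) :
    rowMap F A f (colMap F A g m) = colMap F A g (rowMap F A f m) := by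
  classical
  suffices h : rowMap F A f ∘ₗ colMap F A g = colMap F A g ∘ₗ rowMap F A f from
    LinearMap.congr_fun h m
  refine linearMap_ext fun p q a => ?_
  by_cases h₁ : f p = none <;> by_cases h₂ : g q = none <;>
    simp [h₁, h₂, rowMap_unit, colMap_unit]

theorem rowMap_mul_right (f : Option P → Option P) (m n : FinMat (Option P) A) :
    rowMap F A f (m * n) = rowMap F A f m * n := by
  classical
  induction m using FinMat.induction with
  | zero => simp only [zero_mul, map_zero]
  | add m m' h h' => simp only [add_mul, map_add, h, h']
  | unit p q a =>
    induction n using FinMat.induction with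
    | zero => simp only [mul_zero, map_zero]
    | add n n' h h' => simp only [mul_add, map_add, h, h']
    | unit p' q' b =>
      by_cases h₁ : f p = none <;> by_cases h₂ : q = p' <;>
        simp [h₁, h₂, rowMap_unit, unit_mul_unit]

theorem colMap_mul_left (f : Option P → Option P) (m n : FinMat (Option P) A) :
    colMap F A f (m * n) = m * colMap F A f n := by
  classical
  induction m using FinMat.induction with
  | zero => simp only [zero_mul, map_zero]
  | add m m' h h' => simp only [add_mul, map_add, h, h']
  | unit p q a =>
    induction n using FinMat.induction with
    | zero => simp only [mul_zero, map_zero]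
    | add n n' h h' => simp only [mul_add, map_add, h, h']
    | unit p' q' b =>
      by_cases h₁ : f q' = none <;> by_cases h₂ : q = p' <;>
        simp [h₁, h₂, colMap_unit, unit_mul_unit]

theorem colMap_mul_eq (f g : Option P → Option P)
    (hfg : ∀ x y, x ≠ none → y ≠ none → (f x = y ↔ g y = x))
    (hf : f none = none) (hg : g none = none) (m n : FinMat (Option P) A) :
    colMap F A f m * n = m * rowMap F A g n := by
  classical
  induction m using FinMat.induction with
  | zero => simp only [zero_mul, map_zero]
  | add m m' h h' => simp only [add_mul, map_add, h, h']
  | unit p q a =>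
    induction n using FinMat.induction with
    | zero => simp only [mul_zero, map_zero]
    | add n n' h h' => simp only [mul_add, map_add, h, h']
    | unit p' q' b =>
      rw [colMap_unit, rowMap_unit]
      by_cases hq : q = none
      · subst hq
        by_cases h : g p' = none
        · simp [hf, h]
        · simp [hf, h, unit_mul_unit, Ne.symm h]
      by_cases hp : p' = none
      · subst hp
        by_cases h : f q = none
        · simp [hg, h]
        · simp [hg, h, unit_mul_unit]
      by_cases h : f q = p'
      · have h' := (hfg q p' hq hp).1 h
        simp [h, h', hp, hq, unit_mul_unit]
      · have h' : ¬ q = g p' := fun h' => h ((hfg q p' hq hp).2 h'.symm)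
        by_cases h₁ : f q = none <;> by_cases h₂ : g p' = none <;>
          simp [h₁, h₂, h, h', unit_mul_unit]

end FinMat

/-! ### Wreath products -/

namespace RFGraph

/-- A family of pairwise orthogonal idempotents of `A` (indexed by `ι`), together with a set `D`
of edges that connect vertices of `Γ` to these idempotents. Each vertex emits only finitely many
of these edges, and a sink of `Γ` emits none. -/
structure Linking {V : Type v} {E : Type w} (Γ : RFGraph V E) (A : Type y) [NonUnitalRing A]
    (ι : Type x) (D : Type z) where
  /-- the idempotents -/
  idem : ι → A
  idem_mul_self : ∀ i, idem i * idem i = idem i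
  orthogonal : ∀ i j, i ≠ j → idem i * idem j = 0
  /-- source of a connecting edge -/
  s : D → V
  /-- range of a connecting edge -/
  r : D → ι
  finite_out : ∀ a : V, {d : D | s d = a}.Finite
  sink : ∀ a : V, Γ.IsSink a → ∀ d : D, s d ≠ a

namespace Linking

section General

variable {V : Type v} {E : Type w} {Γ : RFGraph V E} {A : Type y} [NonUnitalRing A]
  {ι : Type x} {D : Type z} (Λ : Linking Γ A ι D)

/-- The finite set of connecting edges with source `a`. -/
def out (a : V) : Finset D := (Λ.finite_out a).toFinset

/-- The nonzero elements of the set `𝒫`: a path in `Γ` followed by a connecting edge.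
In `Option Λ.LinkPath`, which is the whole of `𝒫`, the element `none` is the zero. -/
structure LinkPath where
  /-- the vertex at which the path starts -/
  start : V
  /-- the edges of `Γ` on the path -/
  path : List E
  /-- the connecting edge at the end of the path -/
  last : D
  isPath : Γ.IsPath start path (Λ.s last)

/-- A connecting edge, as an element of `𝒫`. -/
def single (d : D) : Λ.LinkPath := ⟨Λ.s d, [], d, rfl⟩

open Classical in
/-- The left action of the generators of the Cohn algebra on `𝒫`, that is, multiplication on the
left in the Cohn algebra of the graph `Γ` extended by the idempotents and the connecting edges. -/
def act : Gen V E → Option Λ.LinkPath → Option Λ.LinkPath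
  | _, none => none
  | .vert a, some x => if x.start = a then some x else none
  | .edge e, some x =>
      if h : Γ.r e = x.start then some ⟨Γ.s e, e :: x.path, x.last, ⟨rfl, h ▸ x.isPath⟩⟩ else none
  | .ghost _, some ⟨_, [], _, _⟩ => none
  | .ghost e, some ⟨_, f :: p, d, h⟩ => if e = f then some ⟨Γ.r f, p, d, h.2⟩ else none

/-- The involution on generators: `a* = a`, `(e)* = e*`, `(e*)* = e`. -/
def genStar : Gen V E → Gen V E
  | .vert a => .vert a
  | .edge e => .ghost e
  | .ghost e => .edge e

theorem act_none (g : Gen V E) : Λ.act g none = none := by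
  cases g <;> rfl

theorem act_genStar (g : Gen V E) (x y : Option Λ.LinkPath) (hx : x ≠ none) (hy : y ≠ none)
    (h : Λ.act g x = y) : Λ.act (genStar g) y = x := by
  classical
  obtain ⟨x, rfl⟩ := Option.ne_none_iff_exists'.1 hx
  obtain ⟨y, rfl⟩ := Option.ne_none_iff_exists'.1 hy
  obtain ⟨a, p, d, hp⟩ := x
  cases g with
  | vert b =>
    simp only [act] at h
    split_ifs at h with hb
    cases h
    simp only [genStar, act]
    rw [if_pos hb]
  | edge e =>
    simp only [act] at h
    split_ifs at h with hb
    cases h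
    simp only [genStar, act]
    simp [hb]
  | ghost e =>
    cases p with
    | nil => simp [act] at h
    | cons f p =>
      simp only [act] at h
      split_ifs at h with hb
      cases h
      subst hb
      simp only [genStar, act, dite_true]
      simp [hp.1]

theorem act_iff (g : Gen V E) (x y : Option Λ.LinkPath) (hx : x ≠ none) (hy : y ≠ none) :
    Λ.act g x = y ↔ Λ.act (genStar g) y = x :=
  ⟨Λ.act_genStar g x y hx hy, fun h => by
    have := Λ.act_genStar (genStar g) y x hy hx h
    cases g <;> exact this⟩

theorem act_idem (a : V) : Λ.act (.vert a) ∘ Λ.act (.vert a) = Λ.act (.vert a) := by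
  funext x
  cases x with
  | none => rfl
  | some x => by_cases h : x.start = a <;> simp [act, h]

theorem act_orth (a b : V) (hab : a ≠ b) :
    Λ.act (.vert a) ∘ Λ.act (.vert b) = fun _ => none := by
  funext x
  cases x with
  | none => rfl
  | some x =>
    by_cases h : x.start = b
    · simp [act, h, hab.symm]
    · simp [act, h]

theorem act_source_mul (e : E) :
    Λ.act (.vert (Γ.s e)) ∘ Λ.act (.edge e) = Λ.act (.edge e) := by
  funext x
  cases x with
  | none => rfl
  | some x => by_cases h : Γ.r e = x.start <;> simp [act, h]

theorem act_mul_range (e : E) :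
    Λ.act (.edge e) ∘ Λ.act (.vert (Γ.r e)) = Λ.act (.edge e) := by
  funext x
  cases x with
  | none => rfl
  | some x =>
    by_cases h : Γ.r e = x.start
    · simp [act, h]
    · simp [act, h, Ne.symm h]

theorem act_ghost_source (e : E) :
    Λ.act (.ghost e) ∘ Λ.act (.vert (Γ.s e)) = Λ.act (.ghost e) := by
  funext x
  rcases x with _ | ⟨a, _ | ⟨f, p⟩, d, hp⟩
  · rfl
  · by_cases h : a = Γ.s e <;> simp [act, h]
  · have hf : Γ.s f = a := hp.1
    by_cases h : e = f
    · subst h; simp [act, hf]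
    · by_cases h' : a = Γ.s e <;> simp [act, h, h']

theorem act_range_ghost (e : E) :
    Λ.act (.vert (Γ.r e)) ∘ Λ.act (.ghost e) = Λ.act (.ghost e) := by
  funext x
  rcases x with _ | ⟨a, _ | ⟨f, p⟩, d, hp⟩
  · rfl
  · rfl
  · by_cases h : e = f
    · subst h; simp [act]
    · simp [act, h]

theorem act_ghost_ne (e f : E) (hef : e ≠ f) :
    Λ.act (.ghost e) ∘ Λ.act (.edge f) = fun _ => none := by
  funext x
  cases x with
  | none => rfl
  | some x => by_cases h : Γ.r f = x.start <;> simp [act, h, hef]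

theorem act_ghost_self (e : E) :
    Λ.act (.ghost e) ∘ Λ.act (.edge e) = Λ.act (.vert (Γ.r e)) := by
  funext x
  cases x with
  | none => rfl
  | some x =>
    obtain ⟨a, p, d, hp⟩ := x
    by_cases h : Γ.r e = a
    · simp [act, h]
    · simp [act, h, Ne.symm h]

variable (F : Type u) [Field F] [Module F A]

/-- The matrices over `A` with rows and columns indexed by `𝒫`. -/
abbrev Mat : Type (max v w z y) := FinMat (Option Λ.LinkPath) A

/-- The left action of `C(Γ)` on matrices, given by `g a_{x,y} = a_{gx,y}`. -/
def leftAct : Cohn F Γ →ₙₐ[F] Module.End F Λ.Mat :=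
  Cohn.lift Γ (fun g => FinMat.rowMap F A (Λ.act g)) (by
    intro t ht
    cases ht <;>
      simp only [map_sub, map_mul, Cohn.freeLift_of,
        FinMat.rowMap_mul _ _ (Λ.act_none _), act_idem, act_source_mul,
        act_mul_range, act_ghost_source, act_range_ghost, act_ghost_self, sub_self]
    · rw [Λ.act_orth _ _ ‹_›, FinMat.rowMap_none]
    · rw [Λ.act_ghost_ne _ _ ‹_›, FinMat.rowMap_none])

/-- The right action of `C(Γ)` on matrices, given by `a_{x,y} g = a_{x,g*y}`. -/
def rightAct : Cohn F Γ →ₙₐ[F] (Module.End F Λ.Mat)ᵐᵒᵖ :=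
  Cohn.lift Γ (fun g => MulOpposite.op (FinMat.colMap F A (Λ.act (genStar g)))) (by
    intro t ht
    cases ht <;>
      simp only [map_sub, map_mul, Cohn.freeLift_of, ← MulOpposite.op_mul, genStar,
        FinMat.colMap_mul _ _ (Λ.act_none _), act_idem, act_source_mul,
        act_mul_range, act_ghost_source, act_range_ghost, act_ghost_self, sub_self]
    · rw [Λ.act_orth _ _ (Ne.symm ‹_›), FinMat.colMap_none, MulOpposite.op_zero]
    · rw [Λ.act_ghost_ne _ _ (Ne.symm ‹_›), FinMat.colMap_none, MulOpposite.op_zero])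

variable {F}

/-- The left action: `Λ.lact c m` is the product `c m`. -/
def lact (c : Cohn F Γ) : Λ.Mat →ₗ[F] Λ.Mat := Λ.leftAct F c

/-- The right action: `Λ.ract c m` is the product `m c`. -/
def ract (c : Cohn F Γ) : Λ.Mat →ₗ[F] Λ.Mat := (Λ.rightAct F c).unop

theorem lact_of (g : Gen V E) :
    Λ.lact (Cohn.of F Γ g) = FinMat.rowMap F A (Λ.act g) := Cohn.lift_of _ _ _ _

theorem ract_of (g : Gen V E) :
    Λ.ract (Cohn.of F Γ g) = FinMat.colMap F A (Λ.act (genStar g)) :=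
  congrArg MulOpposite.unop (Cohn.lift_of Γ
    (fun g => MulOpposite.op (FinMat.colMap F A (Λ.act (genStar g)))) _ g)

theorem lact_zero : Λ.lact (0 : Cohn F Γ) = 0 := map_zero (Λ.leftAct F)

theorem lact_add (c d : Cohn F Γ) : Λ.lact (c + d) = Λ.lact c + Λ.lact d :=
  map_add (Λ.leftAct F) c d

theorem lact_smul (t : F) (c : Cohn F Γ) : Λ.lact (t • c) = t • Λ.lact c :=
  map_smul (Λ.leftAct F) t c

theorem lact_mul (c d : Cohn F Γ) (m : Λ.Mat) : Λ.lact (c * d) m = Λ.lact c (Λ.lact d m) :=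
  LinearMap.congr_fun (map_mul (Λ.leftAct F) c d) m

theorem ract_zero : Λ.ract (0 : Cohn F Γ) = 0 :=
  congrArg MulOpposite.unop (map_zero (Λ.rightAct F))

theorem ract_add (c d : Cohn F Γ) : Λ.ract (c + d) = Λ.ract c + Λ.ract d :=
  congrArg MulOpposite.unop (map_add (Λ.rightAct F) c d)

theorem ract_smul (t : F) (c : Cohn F Γ) : Λ.ract (t • c) = t • Λ.ract c :=
  congrArg MulOpposite.unop (map_smul (Λ.rightAct F) t c)

theorem ract_mul (c d : Cohn F Γ) (m : Λ.Mat) : Λ.ract (c * d) m = Λ.ract d (Λ.ract c m) :=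
  LinearMap.congr_fun (congrArg MulOpposite.unop (map_mul (Λ.rightAct F) c d)) m

variable [IsScalarTower F A A] [SMulCommClass F A A]

theorem lact_mul_mat (c : Cohn F Γ) (m n : Λ.Mat) : Λ.lact c (m * n) = Λ.lact c m * n := by
  induction c using Cohn.induction generalizing m with
  | gen g => rw [lact_of, FinMat.rowMap_mul_right]
  | zero => simp [lact_zero]
  | add a b ha hb => simp [lact_add, ha, hb, add_mul]
  | mul a b ha hb => simp [lact_mul, ha, hb]
  | smul t a ha => simp [lact_smul, ha, smul_mul_assoc]

theorem mul_ract_mat (c : Cohn F Γ) (m n : Λ.Mat) : Λ.ract c (m * n) = m * Λ.ract c n := by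
  induction c using Cohn.induction generalizing n with
  | gen g => rw [ract_of, FinMat.colMap_mul_left]
  | zero => simp [ract_zero]
  | add a b ha hb => simp [ract_add, ha, hb, mul_add]
  | mul a b ha hb => simp [ract_mul, ha, hb]
  | smul t a ha => simp [ract_smul, ha, mul_smul_comm]

theorem ract_mul_mat (c : Cohn F Γ) (m n : Λ.Mat) : Λ.ract c m * n = m * Λ.lact c n := by
  induction c using Cohn.induction generalizing m n with
  | gen g =>
    rw [ract_of, lact_of]
    exact FinMat.colMap_mul_eq _ _ (fun x y hx hy => (Λ.act_iff g y x hy hx).symm)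
      (Λ.act_none _) (Λ.act_none _) m n
  | zero => simp [ract_zero, lact_zero]
  | add a b ha hb => simp [ract_add, lact_add, ha, hb, mul_add, add_mul]
  | mul a b ha hb => simp [ract_mul, lact_mul, ha, hb]
  | smul t a ha => simp [ract_smul, lact_smul, ha, mul_smul_comm, smul_mul_assoc]

theorem lact_ract_comm (c d : Cohn F Γ) (m : Λ.Mat) :
    Λ.lact c (Λ.ract d m) = Λ.ract d (Λ.lact c m) := by
  induction c using Cohn.induction generalizing m with
  | gen g =>
    induction d using Cohn.induction generalizing m with
    | gen g' => rw [ract_of, lact_of, FinMat.rowMap_colMap]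
    | zero => simp [ract_zero]
    | add a b ha hb => simp [ract_add, ha, hb]
    | mul a b ha hb => simp [ract_mul, ha, hb]
    | smul t a ha => simp [ract_smul, ha]
  | zero => simp [lact_zero]
  | add a b ha hb => simp [lact_add, ha, hb]
  | mul a b ha hb => simp [lact_mul, ha, hb]
  | smul t a ha => simp [lact_smul, ha]

variable (F)

/-- `a ↦ r(p) a`, where `r(p)` is the idempotent at which `p` ends, and `r(0) = 1`. -/
def leftMul : Option Λ.LinkPath → A →ₗ[F] A
  | none => LinearMap.id
  | some p => LinearMap.mulLeft F (Λ.idem (Λ.r p.last))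

/-- `a ↦ a r(q)`, where `r(q)` is the idempotent at which `q` ends, and `r(0) = 1`. -/
def rightMul : Option Λ.LinkPath → A →ₗ[F] A
  | none => LinearMap.id
  | some q => LinearMap.mulRight F (Λ.idem (Λ.r q.last))

/-- The subspace `r(p) A r(q)` of `A`. -/
def corner (p q : Option Λ.LinkPath) : Submodule F A :=
  LinearMap.range (Λ.leftMul F p ∘ₗ Λ.rightMul F q)

theorem corner_mul {p q t : Option Λ.LinkPath} {a b : A} (ha : a ∈ Λ.corner F p q)
    (hb : b ∈ Λ.corner F q t) : a * b ∈ Λ.corner F p t := by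
  obtain ⟨a, rfl⟩ := ha
  obtain ⟨b, rfl⟩ := hb
  refine ⟨Λ.rightMul F q a * Λ.leftMul F q b, ?_⟩
  cases p <;> cases q <;> cases t <;> simp [leftMul, rightMul, mul_assoc]

/-- The algebra `I` of matrices whose `(p,q)`-entry lies in `r(p) A r(q)` for all `p`, `q`,
as a subspace of the space of all matrices. -/
def cornerMat : Submodule F Λ.Mat where
  carrier := {m | ∀ p q, FinMat.entry m p q ∈ Λ.corner F p q}
  add_mem' hm hn p q := by
    rw [FinMat.entry_add]
    exact add_mem (hm p q) (hn p q)
  zero_mem' p q := by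
    rw [FinMat.entry_zero]
    exact zero_mem _
  smul_mem' t m hm p q := by
    rw [FinMat.entry_smul]
    exact Submodule.smul_mem _ t (hm p q)

theorem unit_mem_cornerMat {p q : Option Λ.LinkPath} {a : A} (ha : a ∈ Λ.corner F p q) :
    FinMat.unit p q a ∈ Λ.cornerMat F := by
  classical
  intro p' q'
  rw [FinMat.entry_unit]
  split_ifs with h
  · rwa [← h.1, ← h.2]
  · exact zero_mem _

theorem mul_mem_cornerMat {m n : Λ.Mat} (hm : m ∈ Λ.cornerMat F) (hn : n ∈ Λ.cornerMat F) :
    m * n ∈ Λ.cornerMat F :=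
  FinMat.fm_mul_mem m n _ fun p q t =>
    Λ.unit_mem_cornerMat F (Λ.corner_mul F (hm p q) (hn q t))

theorem act_last (g : Gen V E) (x y : Λ.LinkPath) (h : Λ.act g (some x) = some y) :
    y.last = x.last := by
  obtain ⟨a, p, d, hp⟩ := x
  cases g with
  | vert b =>
    simp only [act] at h
    split_ifs at h
    cases h; rfl
  | edge e =>
    simp only [act] at h
    split_ifs at h
    cases h; rfl
  | ghost e =>
    cases p with
    | nil => simp [act] at h
    | cons f p =>
      simp only [act] at h
      split_ifs at h
      cases h; rfl

theorem leftMul_act (g : Gen V E) (p : Option Λ.LinkPath) (h : Λ.act g p ≠ none) :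
    Λ.leftMul F (Λ.act g p) = Λ.leftMul F p := by
  cases p with
  | none => exact absurd (Λ.act_none g) h
  | some x =>
    obtain ⟨y, hy⟩ := Option.ne_none_iff_exists'.1 h
    rw [hy]
    simp only [leftMul, Λ.act_last g x y hy]

theorem rightMul_act (g : Gen V E) (p : Option Λ.LinkPath) (h : Λ.act g p ≠ none) :
    Λ.rightMul F (Λ.act g p) = Λ.rightMul F p := by
  cases p with
  | none => exact absurd (Λ.act_none g) h
  | some x =>
    obtain ⟨y, hy⟩ := Option.ne_none_iff_exists'.1 h
    rw [hy]
    simp only [rightMul, Λ.act_last g x y hy]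

variable {F}

theorem lact_mem_cornerMat (c : Cohn F Γ) {m : Λ.Mat} (hm : m ∈ Λ.cornerMat F) :
    Λ.lact c m ∈ Λ.cornerMat F := by
  classical
  induction c using Cohn.induction generalizing m with
  | gen g =>
    rw [lact_of]
    refine FinMat.extend_mem _ _ _ fun p q => ?_
    by_cases h : Λ.act g p = none
    · simp [h]
    · simp only [h, if_false]
      refine Λ.unit_mem_cornerMat F ?_
      rw [corner, leftMul_act Λ F g p h]
      exact hm p q
  | zero => simp [lact_zero]
  | add a b ha hb =>
    rw [lact_add]
    exact add_mem (ha hm) (hb hm)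
  | mul a b ha hb =>
    rw [lact_mul]
    exact ha (hb hm)
  | smul t a ha =>
    rw [lact_smul]
    exact Submodule.smul_mem _ t (ha hm)

theorem ract_mem_cornerMat (c : Cohn F Γ) {m : Λ.Mat} (hm : m ∈ Λ.cornerMat F) :
    Λ.ract c m ∈ Λ.cornerMat F := by
  classical
  induction c using Cohn.induction generalizing m with
  | gen g =>
    rw [ract_of]
    refine FinMat.extend_mem _ _ _ fun p q => ?_
    by_cases h : Λ.act (genStar g) q = none
    · simp [h]
    · simp only [h, if_false]
      refine Λ.unit_mem_cornerMat F ?_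
      rw [corner, rightMul_act Λ F _ q h]
      exact hm p q
  | zero => simp [ract_zero]
  | add a b ha hb =>
    rw [ract_add]
    exact add_mem (ha hm) (hb hm)
  | mul a b ha hb =>
    rw [ract_mul]
    exact hb (ha hm)
  | smul t a ha =>
    rw [ract_smul]
    exact Submodule.smul_mem _ t (ha hm)

end General

section Wreath

variable (F : Type u) [Field F] {V : Type v} {E : Type w} {Γ : RFGraph V E}
  {A : Type y} [NonUnitalRing A] [Module F A]
  {ι : Type x} {D : Type z} (Λ : Linking Γ A ι D)

/-- The algebra `C(Γ) + M(A)`: the elements are the pairs `(c, m)`, to be read as the sums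
`c + m`, of an element of the Cohn algebra and a matrix. -/
def CohnMat : Type (max u v w y z) := Cohn F Γ × Λ.Mat

namespace CohnMat

variable {F} {Λ}

instance : AddCommGroup (CohnMat F Λ) := inferInstanceAs (AddCommGroup (Cohn F Γ × Λ.Mat))

instance : Module F (CohnMat F Λ) := inferInstanceAs (Module F (Cohn F Γ × Λ.Mat))

/-- The summand in the Cohn algebra. -/
def cohn (x : CohnMat F Λ) : Cohn F Γ := x.1

/-- The summand in the algebra of matrices. -/
def mat (x : CohnMat F Λ) : Λ.Mat := x.2

variable (Λ) in
/-- The element `c + m`. -/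
def of (c : Cohn F Γ) (m : Λ.Mat) : CohnMat F Λ := (c, m)

@[ext] theorem ext {x y : CohnMat F Λ} (h₁ : x.cohn = y.cohn) (h₂ : x.mat = y.mat) : x = y :=
  Prod.ext h₁ h₂

instance : Mul (CohnMat F Λ) where
  mul x y := of Λ (x.cohn * y.cohn) (Λ.lact x.cohn y.mat + Λ.ract y.cohn x.mat + x.mat * y.mat)

@[simp] theorem cohn_mul (x y : CohnMat F Λ) : (x * y).cohn = x.cohn * y.cohn := rfl

@[simp] theorem mat_mul (x y : CohnMat F Λ) :
    (x * y).mat = Λ.lact x.cohn y.mat + Λ.ract y.cohn x.mat + x.mat * y.mat := rfl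

@[simp] theorem cohn_add (x y : CohnMat F Λ) : (x + y).cohn = x.cohn + y.cohn := rfl

@[simp] theorem mat_add (x y : CohnMat F Λ) : (x + y).mat = x.mat + y.mat := rfl

@[simp] theorem cohn_smul (t : F) (x : CohnMat F Λ) : (t • x).cohn = t • x.cohn := rfl

@[simp] theorem mat_smul (t : F) (x : CohnMat F Λ) : (t • x).mat = t • x.mat := rfl

@[simp] theorem cohn_zero : (0 : CohnMat F Λ).cohn = 0 := rfl

@[simp] theorem mat_zero : (0 : CohnMat F Λ).mat = 0 := rfl

variable [IsScalarTower F A A] [SMulCommClass F A A]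

instance : NonUnitalRing (CohnMat F Λ) where
  left_distrib a b c := by
    ext1
    · simp [mul_add]
    · simp only [mat_mul, cohn_add, mat_add, mul_add, map_add, ract_add, LinearMap.add_apply]
      abel
  right_distrib a b c := by
    ext1
    · simp [add_mul]
    · simp only [mat_mul, cohn_add, mat_add, add_mul, map_add, lact_add, LinearMap.add_apply]
      abel
  zero_mul a := by ext1 <;> simp [lact_zero]
  mul_zero a := by ext1 <;> simp [ract_zero]
  mul_assoc a b c := by
    ext1
    · simp [mul_assoc]
    · simp only [mat_mul, cohn_mul, map_add, lact_mul, ract_mul, add_mul, mul_add, mul_assoc,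
        lact_mul_mat, mul_ract_mat, ract_mul_mat, lact_ract_comm]
      abel

instance : IsScalarTower F (CohnMat F Λ) (CohnMat F Λ) where
  smul_assoc t a b := by
    simp only [smul_eq_mul]
    ext1
    · simp [smul_mul_assoc]
    · simp [lact_smul, smul_mul_assoc, smul_add]

instance : SMulCommClass F (CohnMat F Λ) (CohnMat F Λ) where
  smul_comm t a b := by
    simp only [smul_eq_mul]
    ext1
    · simp [mul_smul_comm]
    · simp [ract_smul, mul_smul_comm, smul_add]

end CohnMat

variable [IsScalarTower F A A] [SMulCommClass F A A]

/-- The subalgebra `C(Γ) + I` of `C(Γ) + M(A)`. -/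
def cohnCorner : NonUnitalSubalgebra F (CohnMat F Λ) where
  carrier := {x | x.mat ∈ Λ.cornerMat F}
  add_mem' hx hy := add_mem (S := Submodule F Λ.Mat) (s := Λ.cornerMat F) hx hy
  zero_mem' := zero_mem (Λ.cornerMat F)
  smul_mem' t _ hx := Submodule.smul_mem (Λ.cornerMat F) t hx
  mul_mem' {x y} hx hy :=
    add_mem (add_mem (Λ.lact_mem_cornerMat x.cohn hy) (Λ.ract_mem_cornerMat y.cohn hx))
      (Λ.mul_mem_cornerMat F hx hy)

/-- The matrix `CK(a)'' = ∑_{s(e) = a} r(e)_{e,e}`, where `e` runs over the connecting edges. -/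
def ckMat (a : V) : Λ.Mat :=
  ∑ e ∈ Λ.out a, FinMat.unit (some (Λ.single e)) (some (Λ.single e)) (Λ.idem (Λ.r e))

theorem ckMat_mem (a : V) : Λ.ckMat a ∈ Λ.cornerMat F :=
  Submodule.sum_mem _ fun e _ => Λ.unit_mem_cornerMat F
    ⟨Λ.idem (Λ.r e), by simp [leftMul, rightMul, single, Λ.idem_mul_self]⟩

/-- The element `CK(a) = CK(a)' - CK(a)''` of `C(Γ) + I`. -/
def CK (a : V) : cohnCorner F Λ :=
  ⟨CohnMat.of Λ (ck F Γ a) (-Λ.ckMat a), neg_mem (S := Submodule F Λ.Mat) (Λ.ckMat_mem F a)⟩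

/-- The wreath product `A wr L(Γ)` with respect to the given idempotents of `A` and connecting
edges: the quotient of `C(Γ) + I` by the ideal generated by the elements `CK(a)`, where `a` runs
over the nonsink vertices of `Γ`. -/
abbrev Wreath : Type (max u v w y z) :=
  AlgQuot F {x : cohnCorner F Λ | ∃ a : V, ¬ Γ.IsSink a ∧ x = CK F Λ a}

end Wreath

end Linking

/-! ### The idempotents and connecting edges given by a hereditary saturated set -/

section HereditarySaturated

variable (F : Type u) [Field F] {V : Type v} {E : Type w} {Γ : RFGraph V E}

/-- For a hereditary saturated set `W` of vertices of `Γ`, the graph `Γ/W` is connected to the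
idempotents `W` of the algebra `L(Γ(W))` by the edges from `E(V \ W, W)`. -/
def linking {W : Set V} (hW : Γ.Hereditary W) (hW' : Γ.Saturated W) :
    Linking (Γ.quotient hW) (Leavitt F (Γ.restrict W)) W {e : E // Γ.s e ∉ W ∧ Γ.r e ∈ W} where
  idem a := Leavitt.of F (Γ.restrict W) (.vert a)
  idem_mul_self a := by
    have h : Cohn.of F (Γ.restrict W) (.vert a) * Cohn.of F (Γ.restrict W) (.vert a)
        - Cohn.of F (Γ.restrict W) (.vert a) = 0 :=
      AlgQuot.mk_eq_zero (F := F) _ (CohnRel.idem a)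
    rw [Leavitt.of, ← map_mul, sub_eq_zero.1 h]
  orthogonal a b hab := by
    have h : Cohn.of F (Γ.restrict W) (.vert a) * Cohn.of F (Γ.restrict W) (.vert b) = 0 :=
      AlgQuot.mk_eq_zero (F := F) _ (CohnRel.orth a b hab)
    rw [Leavitt.of, Leavitt.of, ← map_mul, h, map_zero]
  s e := ⟨Γ.s e.1, e.2.1⟩
  r e := ⟨Γ.r e.1, e.2.2⟩
  finite_out a :=
    Set.Finite.subset ((Γ.finite_out a.1).preimage Subtype.val_injective.injOn)
      fun _ he => congrArg Subtype.val he
  sink a ha d hd := by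
    refine a.2 (hW' a.1 (fun h => h d.1 (congrArg Subtype.val hd)) fun e he => ?_)
    by_contra hr
    exact ha ⟨e, hr⟩ (Subtype.ext he)

end HereditarySaturated

end RFGraph

end

/-! The wreath product is built so that the index `0` of 𝒫 (`none`) carries a copy of A = L(Γ(W)) at
position (0,0), while C(Γ/W) carries the rest of Γ. A connecting edge e bridges the two: it goes to
r(e)_{e,0}, and e* goes to r(e)_{0,e}. With these images all Cohn relations of Γ already hold in
C(Γ/W) + I (`isCohnFamily_toCohnMat`). At a vertex of W the Cuntz–Krieger relation is that of
L(Γ(W)). At a vertex v outside W one has ee* = r(e)_{e,e} for connecting edges, so v - ∑ ff* is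
exactly the relator CK(v) (`toCohnMat_ck_of_notMem`). This gives L(Γ) → A wr L(Γ/W).

In the other direction, an element x of 𝒫 is read as a word in L(Γ), with `0` as a formal unit, and
a_{x,y} is sent to x a y*. This respects products on I because y* x is r(y) for x = y and 0
otherwise: a connecting edge can occur only as the last edge of an element of 𝒫, so none is a proper
initial segment of another (`ghostWord_mul_pathWord`); and the words start outside W, so they are
orthogonal to L(Γ(W)) on that side. The corner condition defining I makes the remaining r(y)
harmless. The map kills CK(v), and comparison on generators shows that it is a left inverse of the
first map, which is therefore injective.

The second composite is never computed. Instead, the images of the generators of L(Γ) generate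
C(Γ/W) + I, since a_{x,y} = r(x)_{x,0} a_{0,0} r(y)_{0,y} on corners (`unit_mem`), which gives
surjectivity.

Heredity keeps every edge emitted from W inside Γ(W). Saturation ensures that a nonsink outside W
does not become a sink of Γ/W, so its relation is indeed imposed in the wreath product. -/

noncomputable section

universe u v w x y z

namespace RFGraph

/-! ### Families satisfying the Cohn relations -/

section CohnFamily

variable {V : Type v} {E : Type w} (Γ : RFGraph V E)

/-- A family of elements of a ring, indexed by the generators of the Cohn algebra, that satisfies
the relations of the Cohn algebra. -/
structure IsCohnFamily {B : Type x} [NonUnitalRing B] (φ : Gen V E → B) : Prop where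
  idem (a : V) : φ (.vert a) * φ (.vert a) = φ (.vert a)
  orth (a b : V) (h : a ≠ b) : φ (.vert a) * φ (.vert b) = 0
  source_mul (e : E) : φ (.vert (Γ.s e)) * φ (.edge e) = φ (.edge e)
  mul_range (e : E) : φ (.edge e) * φ (.vert (Γ.r e)) = φ (.edge e)
  ghost_source (e : E) : φ (.ghost e) * φ (.vert (Γ.s e)) = φ (.ghost e)
  range_ghost (e : E) : φ (.vert (Γ.r e)) * φ (.ghost e) = φ (.ghost e)
  ghost_ne (e f : E) (h : e ≠ f) : φ (.ghost e) * φ (.edge f) = 0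
  ghost_self (e : E) : φ (.ghost e) * φ (.edge e) = φ (.vert (Γ.r e))

variable {Γ} {F : Type u} [Field F] {B : Type x} [NonUnitalRing B] [Module F B]

theorem Cohn.isCohnFamily_of : IsCohnFamily Γ (Cohn.of F Γ) where
  idem a := sub_eq_zero.1 (AlgQuot.mk_eq_zero (F := F) _ (CohnRel.idem a))
  orth a b h := AlgQuot.mk_eq_zero (F := F) _ (CohnRel.orth a b h)
  source_mul e := sub_eq_zero.1 (AlgQuot.mk_eq_zero (F := F) _ (CohnRel.source_mul e))
  mul_range e := sub_eq_zero.1 (AlgQuot.mk_eq_zero (F := F) _ (CohnRel.mul_range e))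
  ghost_source e := sub_eq_zero.1 (AlgQuot.mk_eq_zero (F := F) _ (CohnRel.ghost_source e))
  range_ghost e := sub_eq_zero.1 (AlgQuot.mk_eq_zero (F := F) _ (CohnRel.range_ghost e))
  ghost_ne e f h := AlgQuot.mk_eq_zero (F := F) _ (CohnRel.ghost_ne e f h)
  ghost_self e := sub_eq_zero.1 (AlgQuot.mk_eq_zero (F := F) _ (CohnRel.ghost_self e))

theorem IsCohnFamily.map {B' : Type y} [NonUnitalRing B'] [Module F B'] {φ : Gen V E → B}
    (h : IsCohnFamily Γ φ) (f : B →ₙₐ[F] B') : IsCohnFamily Γ (fun g => f (φ g)) where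
  idem a := by rw [← map_mul, h.idem]
  orth a b hab := by rw [← map_mul, h.orth a b hab, map_zero]
  source_mul e := by rw [← map_mul, h.source_mul]
  mul_range e := by rw [← map_mul, h.mul_range]
  ghost_source e := by rw [← map_mul, h.ghost_source]
  range_ghost e := by rw [← map_mul, h.range_ghost]
  ghost_ne e f hef := by rw [← map_mul, h.ghost_ne e f hef, map_zero]
  ghost_self e := by rw [← map_mul, h.ghost_self]

theorem Leavitt.isCohnFamily_of : IsCohnFamily Γ (Leavitt.of F Γ) :=
  Cohn.isCohnFamily_of.map (AlgQuot.mk _)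

theorem Leavitt.vert_eq_sum {a : V} (ha : ¬ Γ.IsSink a) :
    Leavitt.of F Γ (.vert a) = ∑ f ∈ Γ.out a, Leavitt.of F Γ (.edge f) * Leavitt.of F Γ (.ghost f) := by
  have h : AlgQuot.mk (F := F) {c : Cohn F Γ | ∃ a : V, ¬ Γ.IsSink a ∧ c = ck F Γ a} (ck F Γ a) = 0 :=
    AlgQuot.mk_eq_zero _ ⟨a, ha, rfl⟩
  rw [ck, map_sub, sub_eq_zero, map_sum] at h
  simp only [map_mul] at h
  exact h

variable [IsScalarTower F B B] [SMulCommClass F B B]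

/-- The homomorphism from the Cohn algebra given by a family that satisfies the relations. -/
def Cohn.liftFamily (φ : Gen V E → B) (h : IsCohnFamily Γ φ) : Cohn F Γ →ₙₐ[F] B :=
  Cohn.lift Γ φ (by
    intro t ht
    cases ht <;> simp only [map_sub, map_mul, Cohn.freeLift_of, h.idem, h.source_mul, h.mul_range,
      h.ghost_source, h.range_ghost, h.ghost_self, sub_self]
    · exact h.orth _ _ ‹_›
    · exact h.ghost_ne _ _ ‹_›)

theorem Cohn.liftFamily_of (φ : Gen V E → B) (h : IsCohnFamily Γ φ) (g : Gen V E) :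
    Cohn.liftFamily (F := F) φ h (Cohn.of F Γ g) = φ g := Cohn.lift_of _ _ _ _

/-- The homomorphism from the Leavitt path algebra given by a family that satisfies the
relations. -/
def Leavitt.liftFamily (φ : Gen V E → B) (h : IsCohnFamily Γ φ)
    (hck : ∀ a, ¬ Γ.IsSink a → φ (.vert a) = ∑ f ∈ Γ.out a, φ (.edge f) * φ (.ghost f)) :
    Leavitt F Γ →ₙₐ[F] B :=
  AlgQuot.lift _ (Cohn.liftFamily φ h) (by
    rintro _ ⟨a, ha, rfl⟩
    rw [ck, map_sub, map_sum, sub_eq_zero]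
    simpa only [map_mul, Cohn.liftFamily_of] using hck a ha)

theorem Leavitt.liftFamily_of (φ : Gen V E → B) (h : IsCohnFamily Γ φ)
    (hck : ∀ a, ¬ Γ.IsSink a → φ (.vert a) = ∑ f ∈ Γ.out a, φ (.edge f) * φ (.ghost f))
    (g : Gen V E) : Leavitt.liftFamily (F := F) φ h hck (Leavitt.of F Γ g) = φ g :=
  Cohn.liftFamily_of φ h g

theorem Leavitt.induction {motive : Leavitt F Γ → Prop} (c : Leavitt F Γ)
    (gen : ∀ g, motive (Leavitt.of F Γ g)) (zero : motive 0)
    (add : ∀ a b, motive a → motive b → motive (a + b))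
    (mul : ∀ a b, motive a → motive b → motive (a * b))
    (smul : ∀ (t : F) a, motive a → motive (t • a)) : motive c := by
  obtain ⟨c, rfl⟩ := AlgQuot.mk_surjective _ c
  induction c using Cohn.induction with
  | gen g => exact gen g
  | zero => rwa [map_zero]
  | add a b ha hb => rw [map_add]; exact add _ _ ha hb
  | mul a b ha hb => rw [map_mul]; exact mul _ _ ha hb
  | smul t a ha => rw [map_smul]; exact smul _ _ ha

end CohnFamily

/-! ### Sinks and emitted edges in Γ(W) and Γ/W -/

section SubQuotient

variable {V : Type v} {E : Type w} {Γ : RFGraph V E} {W : Set V}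

theorem restrict_s (e : {e : E // Γ.s e ∈ W ∧ Γ.r e ∈ W}) :
    (Γ.restrict W).s e = ⟨Γ.s e.1, e.2.1⟩ := rfl

theorem restrict_r (e : {e : E // Γ.s e ∈ W ∧ Γ.r e ∈ W}) :
    (Γ.restrict W).r e = ⟨Γ.r e.1, e.2.2⟩ := rfl

theorem quotient_s (hW : Γ.Hereditary W) (e : {e : E // Γ.r e ∉ W}) :
    (Γ.quotient hW).s e = ⟨Γ.s e.1, fun h => e.2 (hW e.1 h)⟩ := rfl

theorem quotient_r (hW : Γ.Hereditary W) (e : {e : E // Γ.r e ∉ W}) :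
    (Γ.quotient hW).r e = ⟨Γ.r e.1, e.2⟩ := rfl

theorem linking_s (F : Type u) [Field F] (hW : Γ.Hereditary W) (hW' : Γ.Saturated W)
    (d : {e : E // Γ.s e ∉ W ∧ Γ.r e ∈ W}) :
    (linking F hW hW').s d = ⟨Γ.s d.1, d.2.1⟩ := rfl

theorem linking_idem (F : Type u) [Field F] (hW : Γ.Hereditary W) (hW' : Γ.Saturated W) (a : W) :
    (linking F hW hW').idem a = Leavitt.of F (Γ.restrict W) (.vert a) := rfl

/-- By heredity, a vertex of W loses no edge on passing to Γ(W). -/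
theorem isSink_restrict (hW : Γ.Hereditary W) (a : W) :
    (Γ.restrict W).IsSink a ↔ Γ.IsSink a.1 :=
  ⟨fun h e he => h ⟨e, he ▸ a.2, hW e (he ▸ a.2)⟩ (Subtype.ext he),
    fun h e he => h e.1 (congrArg Subtype.val he)⟩

/-- If every edge emitted by a nonsink outside W were lost, all of them would end in W, and
saturation would put the vertex into W. -/
theorem isSink_quotient (hW : Γ.Hereditary W) (hW' : Γ.Saturated W) (a : {a : V // a ∉ W}) :
    (Γ.quotient hW).IsSink a ↔ Γ.IsSink a.1 := by
  refine ⟨fun h => ?_, fun h e he => h e.1 (congrArg Subtype.val he)⟩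
  by_contra hs
  refine a.2 (hW' a.1 hs fun e he => ?_)
  by_contra hr
  exact h ⟨e, hr⟩ (Subtype.ext he)

variable {B : Type x} [AddCommMonoid B] (G : E → B)

theorem mem_out {a : V} {e : E} : e ∈ Γ.out a ↔ Γ.s e = a := by
  simp [out]

theorem sum_out_restrict (hW : Γ.Hereditary W) (a : W) :
    ∑ f ∈ (Γ.restrict W).out a, G f.1 = ∑ f ∈ Γ.out a.1, G f := by
  refine Finset.sum_bij (fun f _ => f.1) (fun f hf => ?_) (fun _ _ _ _ h => Subtype.ext h)
    (fun f hf => ?_) (fun _ _ => rfl)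
  · rw [mem_out] at hf ⊢
    exact congrArg Subtype.val hf
  · rw [mem_out] at hf
    have hs : Γ.s f ∈ W := hf ▸ a.2
    exact ⟨⟨f, hs, hW f hs⟩, mem_out.2 (Subtype.ext hf), rfl⟩

/-- The edges emitted outside W split according to whether their range avoids W (edges of Γ/W) or
lies in W (connecting edges). This is the source of the two sums in CK(v). -/
theorem sum_out_quotient (F : Type u) [Field F] (hW : Γ.Hereditary W) (hW' : Γ.Saturated W)
    (a : {a : V // a ∉ W}) :
    ∑ f ∈ (Γ.quotient hW).out a, G f.1 + ∑ d ∈ (linking F hW hW').out a, G d.1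
      = ∑ f ∈ Γ.out a.1, G f := by
  classical
  have hd {d} : d ∈ (linking F hW hW').out a ↔ Γ.s d.1 = a.1 := by
    rw [Linking.out, Set.Finite.mem_toFinset]
    exact Subtype.ext_iff
  rw [← Finset.sum_filter_not_add_sum_filter (Γ.out a.1) (fun f => Γ.r f ∈ W)]
  congr 1
  · refine Finset.sum_bij (fun f _ => f.1) (fun f hf => ?_) (fun _ _ _ _ h => Subtype.ext h)
      (fun f hf => ?_) (fun _ _ => rfl)
    · rw [mem_out] at hf
      exact Finset.mem_filter.2 ⟨mem_out.2 (congrArg Subtype.val hf), f.2⟩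
    · obtain ⟨hf, hr⟩ := Finset.mem_filter.1 hf
      exact ⟨⟨f, hr⟩, mem_out.2 (Subtype.ext (mem_out.1 hf)), rfl⟩
  · refine Finset.sum_bij (fun f _ => f.1) (fun f hf => ?_) (fun _ _ _ _ h => Subtype.ext h)
      (fun f hf => ?_) (fun _ _ => rfl)
    · exact Finset.mem_filter.2 ⟨mem_out.2 (hd.1 hf), f.2.2⟩
    · obtain ⟨hf, hr⟩ := Finset.mem_filter.1 hf
      exact ⟨⟨f, fun h => a.2 (mem_out.1 hf ▸ h), hr⟩, hd.2 (mem_out.1 hf), rfl⟩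

end SubQuotient

end RFGraph

/-! ### Spanning sets of the corner matrices -/

/-- A matrix is the finite sum of its single-entry parts. -/
theorem FinMat.mem_of_units_mem {F : Type u} [Field F] {X : Type x} {A : Type y} [NonUnitalRing A]
    [Module F A] (N : Submodule F (FinMat X A)) (m : FinMat X A)
    (h : ∀ p q, FinMat.unit p q (FinMat.entry m p q) ∈ N) : m ∈ N := by
  have hm : m = Finsupp.sum (FinMat.toFinsupp m) fun i a => FinMat.unit i.1 i.2 a :=
    (Finsupp.sum_single (FinMat.toFinsupp m)).symm
  rw [hm]
  exact Submodule.sum_mem _ fun i _ => h i.1 i.2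

namespace RFGraph.Linking

variable {F : Type u} [Field F] {V : Type v} {E : Type w} {Γ : RFGraph V E}
  {A : Type y} [NonUnitalRing A] [Module F A] [IsScalarTower F A A] [SMulCommClass F A A]
  {ι : Type x} {D : Type z} {Λ : Linking Γ A ι D}

theorem single_inj {d d' : D} : Λ.single d = Λ.single d' ↔ d = d' :=
  ⟨fun h => congrArg LinkPath.last h, fun h => h ▸ rfl⟩

open Classical in
theorem act_vert_single (a : V) (d : D) :
    Λ.act (.vert a) (some (Λ.single d)) = if Λ.s d = a then some (Λ.single d) else none := rfl

theorem act_ghost_single (e : E) (d : D) : Λ.act (.ghost e) (some (Λ.single d)) = none := rfl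

/-- Membership in I is a condition on each entry, so the single-entry parts of a matrix in I again
lie in I and span it. Claims about I may thus be checked on single entries without losing the corner
condition. -/
theorem le_of_units_mem {N : Submodule F Λ.Mat}
    (h : ∀ p q a, a ∈ Λ.corner F p q → FinMat.unit p q a ∈ N) : Λ.cornerMat F ≤ N :=
  fun m hm => FinMat.mem_of_units_mem N m fun p q => h p q _ (hm p q)

/-- An entry in column y already ends in the idempotent r(y). This absorbs the vertex left over from
y* y = r(y). -/
theorem mul_idem_of_mem_corner {p : Option Λ.LinkPath} {y : Λ.LinkPath} {a : A}
    (ha : a ∈ Λ.corner F p (some y)) : a * Λ.idem (Λ.r y.last) = a := by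
  obtain ⟨a, rfl⟩ := ha
  cases p <;> simp [leftMul, rightMul, mul_assoc, Λ.idem_mul_self]

theorem idem_mul_of_mem_corner {x : Λ.LinkPath} {q : Option Λ.LinkPath} {a : A}
    (ha : a ∈ Λ.corner F (some x) q) : Λ.idem (Λ.r x.last) * a = a := by
  obtain ⟨a, rfl⟩ := ha
  cases q <;> simp [leftMul, rightMul, ← mul_assoc, Λ.idem_mul_self]

/-! ### Products of the two summands of C(Γ) + M(A) -/

namespace CohnMat

variable (Λ F) in
/-- The embedding of the Cohn algebra. -/
def inl : Cohn F Γ →ₗ[F] CohnMat F Λ := LinearMap.inl F (Cohn F Γ) Λ.Mat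

variable (Λ F) in
/-- The embedding of the algebra of matrices. -/
def inr : Λ.Mat →ₗ[F] CohnMat F Λ := LinearMap.inr F (Cohn F Γ) Λ.Mat

@[simp] theorem cohn_inl (c : Cohn F Γ) : (inl F Λ c).cohn = c := rfl
@[simp] theorem mat_inl (c : Cohn F Γ) : (inl F Λ c).mat = 0 := rfl
@[simp] theorem cohn_inr (m : Λ.Mat) : (inr F Λ m).cohn = 0 := rfl
@[simp] theorem mat_inr (m : Λ.Mat) : (inr F Λ m).mat = m := rfl

theorem inl_mul_inl (c d : Cohn F Γ) : inl F Λ c * inl F Λ d = inl F Λ (c * d) := by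
  ext1 <;> simp

theorem inr_mul_inr (m n : Λ.Mat) : inr F Λ m * inr F Λ n = inr F Λ (m * n) := by
  ext1 <;> simp [lact_zero, ract_zero]

theorem inl_mul_inr (c : Cohn F Γ) (m : Λ.Mat) : inl F Λ c * inr F Λ m = inr F Λ (Λ.lact c m) := by
  ext1 <;> simp [ract_zero]

theorem inr_mul_inl (m : Λ.Mat) (c : Cohn F Γ) : inr F Λ m * inl F Λ c = inr F Λ (Λ.ract c m) := by
  ext1 <;> simp [lact_zero]

theorem eq_inl_add_inr (x : CohnMat F Λ) : x = inl F Λ x.cohn + inr F Λ x.mat := by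
  ext1 <;> simp

end CohnMat

end RFGraph.Linking

/-! ### The homomorphism from the Leavitt path algebra to the wreath product -/

namespace RFGraph

section ToWreath

variable (F : Type u) [Field F] {V : Type v} {E : Type w} {Γ : RFGraph V E} {W : Set V}
  (hW : Γ.Hereditary W) (hW' : Γ.Saturated W)

open Linking CohnMat Classical

/-- The image in `C(Γ/W) + M(L(Γ(W)))` of a generator of `L(Γ)`. -/
def toCohnMat : Gen V E → CohnMat F (linking F hW hW')
  | .vert a =>
      -- The index `none` is the zero of 𝒫; every generator of C(Γ/W) kills it, so position (0,0) is
      -- free to hold L(Γ(W)), orthogonal to C(Γ/W).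
      if h : a ∈ W then inr F _ (FinMat.unit none none (Leavitt.of F (Γ.restrict W) (.vert ⟨a, h⟩)))
      else inl F _ (Cohn.of F (Γ.quotient hW) (.vert ⟨a, h⟩))
  | .edge e =>
      if hr : Γ.r e ∈ W then
        if hs : Γ.s e ∈ W then
          inr F _ (FinMat.unit none none (Leavitt.of F (Γ.restrict W) (.edge ⟨e, hs, hr⟩)))
        -- A connecting edge e moves from row e to the block of L(Γ(W)) in column 0: it becomes
        -- r(e)_{e,0}.
        else inr F _ (FinMat.unit (some ((linking F hW hW').single ⟨e, hs, hr⟩)) none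
          (Leavitt.of F (Γ.restrict W) (.vert ⟨Γ.r e, hr⟩)))
      else inl F _ (Cohn.of F (Γ.quotient hW) (.edge ⟨e, hr⟩))
  | .ghost e =>
      if hr : Γ.r e ∈ W then
        if hs : Γ.s e ∈ W then
          inr F _ (FinMat.unit none none (Leavitt.of F (Γ.restrict W) (.ghost ⟨e, hs, hr⟩)))
        else inr F _ (FinMat.unit none (some ((linking F hW hW').single ⟨e, hs, hr⟩))
          (Leavitt.of F (Γ.restrict W) (.vert ⟨Γ.r e, hr⟩)))
      else inl F _ (Cohn.of F (Γ.quotient hW) (.ghost ⟨e, hr⟩))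

theorem toCohnMat_mem (g : Gen V E) : toCohnMat F hW hW' g ∈ cohnCorner F (linking F hW hW') := by
  have h0 (c) : inl F (linking F hW hW') c ∈ cohnCorner F (linking F hW hW') :=
    zero_mem ((linking F hW hW').cornerMat F)
  have h1 {p q a} (h : a ∈ (linking F hW hW').corner F p q) :
      inr F (linking F hW hW') (FinMat.unit p q a) ∈ cohnCorner F (linking F hW hW') :=
    (linking F hW hW').unit_mem_cornerMat F h
  -- Since r(0) = 1, the corner at (0,0) is all of A.
  have hn (a) : a ∈ (linking F hW hW').corner F none none := ⟨a, rfl⟩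
  cases g with
  | vert a =>
    simp only [toCohnMat]
    split_ifs
    · exact h1 (hn _)
    · exact h0 _
  | edge e =>
    simp only [toCohnMat]
    split_ifs with hr hs
    · exact h1 (hn _)
    -- The entry r(e) lies in r(e)A because it is its own square.
    · exact h1 ⟨(linking F hW hW').idem ⟨Γ.r e, hr⟩, (linking F hW hW').idem_mul_self ⟨Γ.r e, hr⟩⟩
    · exact h0 _
  | ghost e =>
    simp only [toCohnMat]
    split_ifs with hr hs
    · exact h1 (hn _)
    · exact h1 ⟨(linking F hW hW').idem ⟨Γ.r e, hr⟩, (linking F hW hW').idem_mul_self ⟨Γ.r e, hr⟩⟩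
    · exact h0 _

/-- Factors of the same kind reproduce a relation of L(Γ(W)) or of C(Γ/W). Mixed products are
governed by the action on 𝒫, which kills `0` and lets no ghost edge of Γ/W cancel a connecting edge.
For connecting edges, e*f = r(e)_{0,e} r(f)_{f,0} is r(e)_{0,0} if e = f and 0 otherwise. No
Cuntz–Krieger relation is needed, so this holds before the quotient is taken. -/
theorem isCohnFamily_toCohnMat : IsCohnFamily Γ (toCohnMat F hW hW') := by
  have C := Cohn.isCohnFamily_of (F := F) (Γ := Γ.quotient hW)
  have L := Leavitt.isCohnFamily_of (F := F) (Γ := Γ.restrict W)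
  have Cs := C.source_mul
  have Cr := C.mul_range
  have Cgs := C.ghost_source
  have Crg := C.range_ghost
  have Cg := C.ghost_self
  have Ls := L.source_mul
  have Lr := L.mul_range
  have Lgs := L.ghost_source
  have Lrg := L.range_ghost
  have Lg := L.ghost_self
  simp only [quotient_s, quotient_r] at Cs Cr Cgs Crg Cg
  simp only [restrict_s, restrict_r] at Ls Lr Lgs Lrg Lg
  refine ⟨fun a => ?_, fun a b h => ?_, fun e => ?_, fun e => ?_, fun e => ?_, fun e => ?_,
    fun e f h => ?_, fun e => ?_⟩
  · by_cases ha : a ∈ W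
    · simp [toCohnMat, ha, inr_mul_inr, FinMat.unit_mul_unit, L.idem]
    · simp [toCohnMat, ha, inl_mul_inl, C.idem]
  · by_cases ha : a ∈ W <;> by_cases hb : b ∈ W
    · simp [toCohnMat, ha, hb, inr_mul_inr, FinMat.unit_mul_unit, FinMat.unit_zero,
        L.orth ⟨a, ha⟩ ⟨b, hb⟩ (by simpa using h)]
    · simp [toCohnMat, ha, hb, inr_mul_inl, ract_of, FinMat.colMap_unit, act_none]
    · simp [toCohnMat, ha, hb, inl_mul_inr, lact_of, FinMat.rowMap_unit, act_none]
    · simp [toCohnMat, ha, hb, inl_mul_inl,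
        C.orth ⟨a, ha⟩ ⟨b, hb⟩ (by simpa using h)]
  · by_cases hs : Γ.s e ∈ W
    · have hr := hW e hs
      simp [toCohnMat, hs, hr, inr_mul_inr, FinMat.unit_mul_unit, Ls ⟨e, hs, hr⟩]
    · by_cases hr : Γ.r e ∈ W
      · simp [toCohnMat, hs, hr, inl_mul_inr, lact_of, FinMat.rowMap_unit, act_vert_single, linking_s]
      · simp [toCohnMat, hs, hr, inl_mul_inl, Cs ⟨e, hr⟩]
  · by_cases hs : Γ.s e ∈ W
    · have hr := hW e hs
      simp [toCohnMat, hs, hr, inr_mul_inr, FinMat.unit_mul_unit, Lr ⟨e, hs, hr⟩]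
    · by_cases hr : Γ.r e ∈ W
      · simp [toCohnMat, hs, hr, inr_mul_inr, FinMat.unit_mul_unit, L.idem]
      · simp [toCohnMat, hr, inl_mul_inl, Cr ⟨e, hr⟩]
  · by_cases hs : Γ.s e ∈ W
    · have hr := hW e hs
      simp [toCohnMat, hs, hr, inr_mul_inr, FinMat.unit_mul_unit, Lgs ⟨e, hs, hr⟩]
    · by_cases hr : Γ.r e ∈ W
      · simp [toCohnMat, hs, hr, inr_mul_inl, ract_of, FinMat.colMap_unit, genStar,
          act_vert_single, linking_s]
      · simp [toCohnMat, hs, hr, inl_mul_inl, Cgs ⟨e, hr⟩]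
  · by_cases hs : Γ.s e ∈ W
    · have hr := hW e hs
      simp [toCohnMat, hs, hr, inr_mul_inr, FinMat.unit_mul_unit, Lrg ⟨e, hs, hr⟩]
    · by_cases hr : Γ.r e ∈ W
      · simp [toCohnMat, hs, hr, inr_mul_inr, FinMat.unit_mul_unit, L.idem]
      · simp [toCohnMat, hr, inl_mul_inl, Crg ⟨e, hr⟩]
  · by_cases her : Γ.r e ∈ W <;> by_cases hfr : Γ.r f ∈ W
    · by_cases hes : Γ.s e ∈ W <;> by_cases hfs : Γ.s f ∈ W
      · simp [toCohnMat, her, hfr, hes, hfs, inr_mul_inr, FinMat.unit_mul_unit, FinMat.unit_zero,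
          L.ghost_ne ⟨e, hes, her⟩ ⟨f, hfs, hfr⟩ (by simpa using h)]
      · simp [toCohnMat, her, hfr, hes, hfs, inr_mul_inr, FinMat.unit_mul_unit]
      · simp [toCohnMat, her, hfr, hes, hfs, inr_mul_inr, FinMat.unit_mul_unit]
      · simp [toCohnMat, her, hfr, hes, hfs, inr_mul_inr, FinMat.unit_mul_unit, single_inj, h]
    · by_cases hes : Γ.s e ∈ W
      · simp [toCohnMat, her, hfr, hes, inr_mul_inl, ract_of, FinMat.colMap_unit, act_none]
      · simp [toCohnMat, her, hfr, hes, inr_mul_inl, ract_of, FinMat.colMap_unit, genStar,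
          act_ghost_single]
    · by_cases hfs : Γ.s f ∈ W
      · simp [toCohnMat, her, hfr, hfs, inl_mul_inr, lact_of, FinMat.rowMap_unit, act_none]
      · simp [toCohnMat, her, hfr, hfs, inl_mul_inr, lact_of, FinMat.rowMap_unit, act_ghost_single]
    · simp [toCohnMat, her, hfr, inl_mul_inl,
        C.ghost_ne ⟨e, her⟩ ⟨f, hfr⟩ (by simpa using h)]
  · by_cases hs : Γ.s e ∈ W
    · have hr := hW e hs
      simp [toCohnMat, hs, hr, inr_mul_inr, FinMat.unit_mul_unit, Lg ⟨e, hs, hr⟩]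
    · by_cases hr : Γ.r e ∈ W
      · simp [toCohnMat, hs, hr, inr_mul_inr, FinMat.unit_mul_unit, L.idem]
      · simp [toCohnMat, hr, inl_mul_inl, Cg ⟨e, hr⟩]

/-- The image in `C(Γ/W) + I` of a generator of `L(Γ)`. -/
def toCohnCorner (g : Gen V E) : cohnCorner F (linking F hW hW') :=
  ⟨toCohnMat F hW hW' g, toCohnMat_mem F hW hW' g⟩

theorem isCohnFamily_toCohnCorner : IsCohnFamily Γ (toCohnCorner F hW hW') := by
  have h := isCohnFamily_toCohnMat F hW hW'
  exact ⟨fun a => Subtype.ext (h.idem a), fun a b hab => Subtype.ext (h.orth a b hab),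
    fun e => Subtype.ext (h.source_mul e), fun e => Subtype.ext (h.mul_range e),
    fun e => Subtype.ext (h.ghost_source e), fun e => Subtype.ext (h.range_ghost e),
    fun e f hef => Subtype.ext (h.ghost_ne e f hef), fun e => Subtype.ext (h.ghost_self e)⟩

/-- By heredity all edges involved lie in Γ(W), so this is the relation of L(Γ(W)) placed at
position (0,0). -/
theorem toCohnMat_ck_of_mem {a : V} (ha : a ∈ W) (hs : ¬ Γ.IsSink a) :
    toCohnMat F hW hW' (.vert a)
      = ∑ f ∈ Γ.out a, toCohnMat F hW hW' (.edge f) * toCohnMat F hW hW' (.ghost f) := by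
  have key : ∀ f : {e // Γ.s e ∈ W ∧ Γ.r e ∈ W},
      toCohnMat F hW hW' (.edge f.1) * toCohnMat F hW hW' (.ghost f.1)
        = inr F _ (FinMat.unitLin F none none (Leavitt.of F (Γ.restrict W) (.edge f)
            * Leavitt.of F (Γ.restrict W) (.ghost f))) := by
    rintro ⟨f, hfs, hfr⟩
    simp only [toCohnMat, hfs, hfr, dite_true, inr_mul_inr, FinMat.unit_mul_unit, if_true]
    rfl
  rw [← sum_out_restrict (fun f => toCohnMat F hW hW' (.edge f) * toCohnMat F hW hW' (.ghost f))
    hW ⟨a, ha⟩]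
  simp only [key]
  rw [← map_sum, ← map_sum, ← Leavitt.vert_eq_sum ((isSink_restrict hW ⟨a, ha⟩).not.2 hs)]
  simp only [toCohnMat, ha, dite_true]
  rfl

/-- Edges of Γ/W contribute ff* in the Cohn algebra, and each connecting edge contributes r(e)_{e,0}
r(e)_{0,e} = r(e)_{e,e}. The defect of the Cuntz–Krieger relation is therefore the relator of the
wreath product itself. -/
theorem toCohnMat_ck_of_notMem {a : V} (ha : a ∉ W) :
    toCohnMat F hW hW' (.vert a)
      - ∑ f ∈ Γ.out a, toCohnMat F hW hW' (.edge f) * toCohnMat F hW hW' (.ghost f)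
      = (CK F (linking F hW hW') ⟨a, ha⟩ : CohnMat F (linking F hW hW')) := by
  have key : ∀ f : {e // Γ.r e ∉ W},
      toCohnMat F hW hW' (.edge f.1) * toCohnMat F hW hW' (.ghost f.1)
        = inl F _ (Cohn.of F (Γ.quotient hW) (.edge f)
            * Cohn.of F (Γ.quotient hW) (.ghost f)) := by
    rintro ⟨f, hfr⟩
    simp only [toCohnMat, hfr, dite_false, inl_mul_inl]
  have key' : ∀ d : {e // Γ.s e ∉ W ∧ Γ.r e ∈ W},
      toCohnMat F hW hW' (.edge d.1) * toCohnMat F hW hW' (.ghost d.1)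
        = inr F _ (FinMat.unit (some ((linking F hW hW').single d))
            (some ((linking F hW hW').single d))
              ((linking F hW hW').idem ((linking F hW hW').r d))) := by
    rintro ⟨f, hfs, hfr⟩
    simp only [toCohnMat, hfs, hfr, dite_true, dite_false, inr_mul_inr, FinMat.unit_mul_unit,
      if_true, Leavitt.isCohnFamily_of.idem]
    rfl
  rw [← sum_out_quotient (fun f => toCohnMat F hW hW' (.edge f) * toCohnMat F hW hW' (.ghost f))
    F hW hW' ⟨a, ha⟩]
  simp only [key, key', ← map_sum]
  simp only [toCohnMat, ha, dite_false]
  rw [← sub_sub, ← map_sub, sub_eq_add_neg, ← map_neg]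
  exact (eq_inl_add_inr (CK F (linking F hW hW') ⟨a, ha⟩).1).symm

/-- The homomorphism from the Leavitt path algebra to the wreath product. -/
def toWreath : Leavitt F Γ →ₙₐ[F] Wreath F (linking F hW hW') :=
  Leavitt.liftFamily (fun g => AlgQuot.mk _ (toCohnCorner F hW hW' g))
    ((isCohnFamily_toCohnCorner F hW hW').map (AlgQuot.mk _)) (by
      intro a hs
      simp only [← map_mul, ← map_sum]
      by_cases ha : a ∈ W
      · congr 1
        apply Subtype.ext
        rw [AddSubmonoidClass.coe_finsetSum]
        exact toCohnMat_ck_of_mem F hW hW' ha hs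
      · rw [← sub_eq_zero, ← map_sub]
        -- Saturation enters here: the vertex is still a nonsink of Γ/W, so its relator is among
        -- those divided out.
        refine AlgQuot.mk_eq_zero _ ⟨⟨a, ha⟩, (isSink_quotient hW hW' ⟨a, ha⟩).not.2 hs, ?_⟩
        apply Subtype.ext
        rw [AddSubgroupClass.coe_sub, AddSubmonoidClass.coe_finsetSum]
        exact toCohnMat_ck_of_notMem F hW hW' ha)

theorem toWreath_of (g : Gen V E) : toWreath F hW hW' (Leavitt.of F Γ g)
    = AlgQuot.mk _ (toCohnCorner F hW hW' g) :=
  Leavitt.liftFamily_of _ _ _ _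

end ToWreath

end RFGraph

/-! ### The homomorphism from the wreath product to the Leavitt path algebra -/

namespace RFGraph

/-- The map on generators induced by maps on vertices and edges. -/
def Gen.map {V : Type v} {E : Type w} {V' : Type x} {E' : Type y} (f : V → V') (g : E → E') :
    Gen V E → Gen V' E'
  | .vert a => .vert (f a)
  | .edge e => .edge (g e)
  | .ghost e => .ghost (g e)

section FromWreath

variable (F : Type u) [Field F] {V : Type v} {E : Type w} {Γ : RFGraph V E} {W : Set V}

/-- The homomorphism `L(Γ(W)) → L(Γ)`. -/
def fromRestrict (hW : Γ.Hereditary W) : Leavitt F (Γ.restrict W) →ₙₐ[F] Leavitt F Γ :=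
  have L := Leavitt.isCohnFamily_of (F := F) (Γ := Γ)
  Leavitt.liftFamily (fun g => Leavitt.of F Γ (g.map Subtype.val Subtype.val))
    ⟨fun a => L.idem a.1, fun a b h => L.orth a.1 b.1 (Subtype.val_injective.ne h),
      fun e => L.source_mul e.1, fun e => L.mul_range e.1, fun e => L.ghost_source e.1,
      fun e => L.range_ghost e.1, fun e f h => L.ghost_ne e.1 f.1 (Subtype.val_injective.ne h),
      fun e => L.ghost_self e.1⟩
    (fun a ha => (Leavitt.vert_eq_sum ((isSink_restrict hW a).not.1 ha)).trans
      (sum_out_restrict (fun f => Leavitt.of F Γ (.edge f) * Leavitt.of F Γ (.ghost f)) hW a).symm)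

theorem fromRestrict_of (hW : Γ.Hereditary W) (g) :
    fromRestrict F hW (Leavitt.of F _ g) = Leavitt.of F Γ (g.map Subtype.val Subtype.val) := by
  unfold fromRestrict
  exact Leavitt.liftFamily_of _ _ _ _

/-- The homomorphism `C(Γ/W) → L(Γ)`. -/
def fromQuotient (hW : Γ.Hereditary W) : Cohn F (Γ.quotient hW) →ₙₐ[F] Leavitt F Γ :=
  have L := Leavitt.isCohnFamily_of (F := F) (Γ := Γ)
  Cohn.liftFamily (fun g => Leavitt.of F Γ (g.map Subtype.val Subtype.val))
    ⟨fun a => L.idem a.1, fun a b h => L.orth a.1 b.1 (Subtype.val_injective.ne h),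
      fun e => L.source_mul e.1, fun e => L.mul_range e.1, fun e => L.ghost_source e.1,
      fun e => L.range_ghost e.1, fun e f h => L.ghost_ne e.1 f.1 (Subtype.val_injective.ne h),
      fun e => L.ghost_self e.1⟩

theorem fromQuotient_of (hW : Γ.Hereditary W) (g) :
    fromQuotient F hW (Cohn.of F _ g) = Leavitt.of F Γ (g.map Subtype.val Subtype.val) := by
  unfold fromQuotient
  exact Cohn.liftFamily_of _ _ _

/-! ### Orthogonality of L(Γ(W)) and the generators of C(Γ/W) -/

variable {F}

/-- Every generator of L(Γ(W)) absorbs a vertex of W on its left, and that vertex is orthogonal to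
b; a product inherits the property from its first factor. -/
theorem vert_mul_fromRestrict (hW : Γ.Hereditary W) {b : V} (hb : b ∉ W)
    (a : Leavitt F (Γ.restrict W)) : Leavitt.of F Γ (.vert b) * fromRestrict F hW a = 0 := by
  have L := Leavitt.isCohnFamily_of (F := F) (Γ := Γ)
  have ho (c : W) : Leavitt.of F Γ (.vert b) * Leavitt.of F Γ (.vert c.1) = 0 :=
    L.orth b c.1 fun h => hb (h ▸ c.2)
  induction a using Leavitt.induction with
  | gen g =>
    rw [fromRestrict_of]
    rcases g with c | e | e
    · exact ho c
    · simp only [Gen.map]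
      rw [← L.source_mul, ← mul_assoc, ho ⟨_, e.2.1⟩, zero_mul]
    · simp only [Gen.map]
      rw [← L.range_ghost, ← mul_assoc, ho ⟨_, e.2.2⟩, zero_mul]
  | zero => rw [map_zero, mul_zero]
  | add a a' h h' => rw [map_add, mul_add, h, h', add_zero]
  | mul a a' h h' => rw [map_mul, ← mul_assoc, h, zero_mul]
  | smul t a h => rw [map_smul, mul_smul_comm, h, smul_zero]

theorem fromRestrict_mul_vert (hW : Γ.Hereditary W) {b : V} (hb : b ∉ W)
    (a : Leavitt F (Γ.restrict W)) : fromRestrict F hW a * Leavitt.of F Γ (.vert b) = 0 := by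
  have L := Leavitt.isCohnFamily_of (F := F) (Γ := Γ)
  have ho (c : W) : Leavitt.of F Γ (.vert c.1) * Leavitt.of F Γ (.vert b) = 0 :=
    L.orth c.1 b fun h => hb (h ▸ c.2)
  induction a using Leavitt.induction with
  | gen g =>
    rw [fromRestrict_of]
    rcases g with c | e | e
    · exact ho c
    · simp only [Gen.map]
      rw [← L.mul_range, mul_assoc, ho ⟨_, e.2.2⟩, mul_zero]
    · simp only [Gen.map]
      rw [← L.ghost_source, mul_assoc, ho ⟨_, e.2.1⟩, mul_zero]
  | zero => rw [map_zero, zero_mul]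
  | add a a' h h' => rw [map_add, add_mul, h, h', add_zero]
  | mul a a' h h' => rw [map_mul, mul_assoc, h', mul_zero]
  | smul t a h => rw [map_smul, smul_mul_assoc, h, smul_zero]

/-- A generator of C(Γ/W) absorbs a vertex outside W on its right. For a ghost edge this vertex is
the source, which avoids W by heredity. The result matches the rule that the generators kill the
index `0`. -/
theorem fromQuotient_of_mul_fromRestrict (hW : Γ.Hereditary W) (g)
    (a : Leavitt F (Γ.restrict W)) :
    fromQuotient F hW (Cohn.of F _ g) * fromRestrict F hW a = 0 := by
  have L := Leavitt.isCohnFamily_of (F := F) (Γ := Γ)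
  rw [fromQuotient_of]
  rcases g with c | e | e <;> simp only [Gen.map]
  · exact vert_mul_fromRestrict hW c.2 a
  · rw [← L.mul_range, mul_assoc, vert_mul_fromRestrict hW e.2, mul_zero]
  · rw [← L.ghost_source, mul_assoc, vert_mul_fromRestrict hW fun h => e.2 (hW _ h), mul_zero]

theorem fromRestrict_mul_fromQuotient_of (hW : Γ.Hereditary W) (g)
    (a : Leavitt F (Γ.restrict W)) :
    fromRestrict F hW a * fromQuotient F hW (Cohn.of F _ g) = 0 := by
  have L := Leavitt.isCohnFamily_of (F := F) (Γ := Γ)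
  rw [fromQuotient_of]
  rcases g with c | e | e <;> simp only [Gen.map]
  · exact fromRestrict_mul_vert hW c.2 a
  · rw [← L.source_mul, ← mul_assoc, fromRestrict_mul_vert hW fun h => e.2 (hW _ h), zero_mul]
  · rw [← L.range_ghost, ← mul_assoc, fromRestrict_mul_vert hW e.2, zero_mul]

/-! ### Elements of 𝒫 as words in L(Γ) -/

variable (F Γ) in
/-- The product in `L(Γ)` of the edges of a path in `Γ/W` and a connecting edge. -/
def pathWord : List {e : E // Γ.r e ∉ W} → {e : E // Γ.s e ∉ W ∧ Γ.r e ∈ W} → Leavitt F Γ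
  | [], d => Leavitt.of F Γ (.edge d.1)
  | e :: p, d => Leavitt.of F Γ (.edge e.1) * pathWord p d

variable (F Γ) in
/-- The image of `pathWord` under the involution. -/
def ghostWord : List {e : E // Γ.r e ∉ W} → {e : E // Γ.s e ∉ W ∧ Γ.r e ∈ W} → Leavitt F Γ
  | [], d => Leavitt.of F Γ (.ghost d.1)
  | e :: p, d => ghostWord p d * Leavitt.of F Γ (.ghost e.1)

open Linking

variable {hW : Γ.Hereditary W} {hW' : Γ.Saturated W}

theorem vert_mul_pathWord {a : {a : V // a ∉ W}} {p : List {e : E // Γ.r e ∉ W}}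
    {d : {e : E // Γ.s e ∉ W ∧ Γ.r e ∈ W}}
    (h : (Γ.quotient hW).IsPath a p ((linking F hW hW').s d)) :
    Leavitt.of F Γ (.vert a.1) * pathWord F Γ p d = pathWord F Γ p d := by
  have L := Leavitt.isCohnFamily_of (F := F) (Γ := Γ)
  cases p with
  | nil =>
    obtain rfl : a = (linking F hW hW').s d := h
    exact L.source_mul d.1
  | cons e p =>
    obtain ⟨rfl, -⟩ := h
    rw [pathWord, ← mul_assoc, quotient_s, L.source_mul]

theorem ghostWord_mul_vert {a : {a : V // a ∉ W}} {p : List {e : E // Γ.r e ∉ W}}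
    {d : {e : E // Γ.s e ∉ W ∧ Γ.r e ∈ W}}
    (h : (Γ.quotient hW).IsPath a p ((linking F hW hW').s d)) :
    ghostWord F Γ p d * Leavitt.of F Γ (.vert a.1) = ghostWord F Γ p d := by
  have L := Leavitt.isCohnFamily_of (F := F) (Γ := Γ)
  cases p with
  | nil =>
    obtain rfl : a = (linking F hW hW').s d := h
    exact L.ghost_source d.1
  | cons e p =>
    obtain ⟨rfl, -⟩ := h
    rw [ghostWord, mul_assoc, quotient_s, L.ghost_source]

open Classical in
-- Equal first edges cancel by e*e = r(e), and distinct ones give 0. If one list runs out first, a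
-- connecting edge meets an edge of Γ/W; these differ because only the former ends in W. So a
-- nonzero product requires equal words.
theorem ghostWord_mul_pathWord {d d' : {e : E // Γ.s e ∉ W ∧ Γ.r e ∈ W}}
    {p p' : List {e : E // Γ.r e ∉ W}} {a a' : {a : V // a ∉ W}}
    (h : (Γ.quotient hW).IsPath a p ((linking F hW hW').s d))
    (h' : (Γ.quotient hW).IsPath a' p' ((linking F hW hW').s d')) :
    ghostWord F Γ p d * pathWord F Γ p' d'
      = if p = p' ∧ d = d' then Leavitt.of F Γ (.vert (Γ.r d.1)) else 0 := by
  have L := Leavitt.isCohnFamily_of (F := F) (Γ := Γ)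
  induction p generalizing p' a a' with
  | nil =>
    cases p' with
    | nil =>
      by_cases hd : d = d'
      · subst hd
        simpa [ghostWord, pathWord] using L.ghost_self d.1
      · simpa [ghostWord, pathWord, hd] using L.ghost_ne d.1 d'.1 (Subtype.val_injective.ne hd)
    | cons e p' =>
      have hne : d.1 ≠ e.1 := fun h => e.2 (h ▸ d.2.2)
      simp [ghostWord, pathWord, ← mul_assoc, L.ghost_ne _ _ hne]
  | cons e p ih =>
    cases p' with
    | nil =>
      have hne : e.1 ≠ d'.1 := fun h => e.2 (h ▸ d'.2.2)
      simp [ghostWord, pathWord, mul_assoc, L.ghost_ne _ _ hne]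
    | cons e' p' =>
      rw [ghostWord, pathWord, mul_assoc, ← mul_assoc (Leavitt.of F Γ (.ghost e.1))]
      by_cases he : e = e'
      · subst he
        have := vert_mul_pathWord h'.2
        rw [quotient_r] at this
        rw [L.ghost_self, this, ih h.2 h'.2]
        simp
      · rw [L.ghost_ne _ _ (Subtype.val_injective.ne he)]
        simp [he]

/-! ### Words as multiplication operators, with a formal unit at index `0` -/

variable (hW hW') in
/-- Left multiplication by the element of `L(Γ)` that corresponds to an element of `𝒫`, where the
zero of `𝒫` corresponds to the unit. -/
def leftWord : Option (linking F hW hW').LinkPath → Leavitt F Γ →ₗ[F] Leavitt F Γ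
  | none => LinearMap.id
  | some x => LinearMap.mulLeft F (pathWord F Γ x.path x.last)

variable (hW hW') in
/-- Right multiplication by the involute of the element of `L(Γ)` that corresponds to an element
of `𝒫`, where the zero of `𝒫` corresponds to the unit. -/
def rightWord : Option (linking F hW hW').LinkPath → Leavitt F Γ →ₗ[F] Leavitt F Γ
  | none => LinearMap.id
  | some x => LinearMap.mulRight F (ghostWord F Γ x.path x.last)

theorem leftWord_mul (p) (b c : Leavitt F Γ) :
    leftWord hW hW' p (b * c) = leftWord hW hW' p b * c := by
  cases p <;> simp [leftWord, mul_assoc]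

theorem rightWord_mul (p) (b c : Leavitt F Γ) :
    rightWord hW hW' p (b * c) = b * rightWord hW hW' p c := by
  cases p <;> simp [rightWord, mul_assoc]

theorem leftWord_rightWord (p q) (b : Leavitt F Γ) :
    leftWord hW hW' p (rightWord hW hW' q b) = rightWord hW hW' q (leftWord hW hW' p b) := by
  cases p <;> cases q <;> simp [leftWord, rightWord, mul_assoc]

open Classical in
-- The action on 𝒫 imitates multiplication in the Cohn algebra of the extended graph, and the same
-- rules hold in L(Γ): a vertex fixes or kills a word, an edge is prepended if composable, a ghost
-- edge cancels the first edge or kills the word. At index `0` both sides vanish by orthogonality.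
theorem fromQuotient_of_mul_leftWord (g) (p) (a : Leavitt F (Γ.restrict W)) :
    fromQuotient F hW (Cohn.of F _ g) * leftWord hW hW' p (fromRestrict F hW a)
      = if (linking F hW hW').act g p = none then 0
        else leftWord hW hW' ((linking F hW hW').act g p) (fromRestrict F hW a) := by
  have L := Leavitt.isCohnFamily_of (F := F) (Γ := Γ)
  rcases p with _ | ⟨a, p, d, hp⟩
  · rw [act_none, if_pos rfl]
    exact fromQuotient_of_mul_fromRestrict hW g a
  · have hv := vert_mul_pathWord hp
    rw [fromQuotient_of]
    simp only [leftWord, LinearMap.mulLeft_apply, ← mul_assoc]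
    rcases g with c | e | e <;> simp only [Gen.map, act]
    · by_cases h : a = c
      · subst h
        simp [hv]
      · rw [← hv, ← mul_assoc, L.orth c.1 a.1 (Subtype.val_injective.ne (Ne.symm h))]
        simp [h]
    · by_cases h : (Γ.quotient hW).r e = a
      · simp [h, pathWord, mul_assoc]
      · have h' : Γ.r e.1 ≠ a.1 := fun h' => h (Subtype.ext h')
        have h₀ : Leavitt.of F Γ (.edge e.1) * pathWord F Γ p d = 0 := by
          rw [← hv, ← mul_assoc, ← L.mul_range, mul_assoc (Leavitt.of F Γ (.edge e.1)),
            L.orth _ _ h', mul_zero, zero_mul]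
        simp [h, h₀]
    · cases p with
      | nil =>
        have hne : e.1 ≠ d.1 := fun h => e.2 (h ▸ d.2.2)
        simp [pathWord, L.ghost_ne _ _ hne]
      | cons f p =>
        by_cases h : e = f
        · subst h
          have := vert_mul_pathWord hp.2
          rw [quotient_r] at this
          simp [pathWord, ← mul_assoc, L.ghost_self, this]
        · simp [pathWord, ← mul_assoc, h, L.ghost_ne _ _ (Subtype.val_injective.ne h)]

open Classical in
-- Mirror image of `fromQuotient_of_mul_leftWord`; the involution appears because the right action
-- is x g = g* x.
theorem rightWord_mul_fromQuotient_of (g) (p) (a : Leavitt F (Γ.restrict W)) :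
    rightWord hW hW' p (fromRestrict F hW a) * fromQuotient F hW (Cohn.of F _ g)
      = if (linking F hW hW').act (genStar g) p = none then 0
        else rightWord hW hW' ((linking F hW hW').act (genStar g) p) (fromRestrict F hW a) := by
  have L := Leavitt.isCohnFamily_of (F := F) (Γ := Γ)
  rcases p with _ | ⟨a, p, d, hp⟩
  · rw [act_none, if_pos rfl]
    exact fromRestrict_mul_fromQuotient_of hW g a
  · have hv := ghostWord_mul_vert hp
    rw [fromQuotient_of]
    simp only [rightWord, LinearMap.mulRight_apply, mul_assoc]
    rcases g with c | e | e <;> simp only [Gen.map, act, genStar]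
    · by_cases h : a = c
      · subst h
        simp [hv]
      · rw [← hv, mul_assoc, L.orth a.1 c.1 (Subtype.val_injective.ne h)]
        simp [h]
    · cases p with
      | nil =>
        have hne : d.1 ≠ e.1 := fun h => e.2 (h ▸ d.2.2)
        simp [ghostWord, L.ghost_ne _ _ hne]
      | cons f p =>
        by_cases h : e = f
        · subst h
          have := ghostWord_mul_vert hp.2
          rw [quotient_r] at this
          simp [ghostWord, mul_assoc, L.ghost_self, this]
        · simp [ghostWord, mul_assoc, h, L.ghost_ne _ _ (Subtype.val_injective.ne (Ne.symm h))]
    · by_cases h : (Γ.quotient hW).r e = a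
      · simp [h, ghostWord, mul_assoc]
      · have h' : a.1 ≠ Γ.r e.1 := fun h' => h (Subtype.ext h'.symm)
        have h₀ : ghostWord F Γ p d * Leavitt.of F Γ (.ghost e.1) = 0 := by
          rw [← hv, mul_assoc, ← L.range_ghost, ← mul_assoc (Leavitt.of F Γ (.vert a.1)),
            L.orth _ _ h', zero_mul, mul_zero]
        simp [h, h₀]

open Classical in
-- This is the rule for multiplying matrix units. The delta comes from `ghostWord_mul_pathWord`, or
-- from orthogonality if exactly one index is `0`. For equal nonzero indices the product is a r(y)
-- b, and the corner condition on a turns it into ab.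
theorem rightWord_mul_leftWord {p q q'} {a b : Leavitt F (Γ.restrict W)}
    (ha : a ∈ (linking F hW hW').corner F p q) :
    rightWord hW hW' q (fromRestrict F hW a) * leftWord hW hW' q' (fromRestrict F hW b)
      = if q = q' then fromRestrict F hW (a * b) else 0 := by
  rcases q with _ | y <;> rcases q' with _ | x
  · simp [leftWord, rightWord]
  · simp only [leftWord, rightWord, LinearMap.id_apply, LinearMap.mulLeft_apply]
    rw [← vert_mul_pathWord x.isPath, ← mul_assoc, ← mul_assoc,
      fromRestrict_mul_vert hW x.start.2]
    simp
  · simp only [leftWord, rightWord, LinearMap.id_apply, LinearMap.mulRight_apply]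
    rw [← ghostWord_mul_vert y.isPath, mul_assoc, mul_assoc,
      vert_mul_fromRestrict hW y.start.2]
    simp
  · simp only [leftWord, rightWord, LinearMap.mulRight_apply, LinearMap.mulLeft_apply]
    rw [mul_assoc, ← mul_assoc (ghostWord F Γ _ _), ghostWord_mul_pathWord y.isPath x.isPath]
    by_cases h : y = x
    · subst h
      rw [if_pos ⟨rfl, rfl⟩, if_pos rfl, ← mul_assoc]
      -- Insert r(y) after a, to match the vertex produced by y* y.
      conv_rhs => rw [← mul_idem_of_mem_corner ha, map_mul, map_mul]
      congr 2
      rw [linking_idem, fromRestrict_of]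
      rfl
    · have h' : ¬ (y.path = x.path ∧ y.last = x.last) := by
        rintro ⟨h₁, h₂⟩
        apply h
        obtain ⟨a, p, d, hp⟩ := y
        obtain ⟨a', p', d', hp'⟩ := x
        dsimp only at h₁ h₂
        subst h₁ h₂
        -- The start is determined by the first edge, or by the connecting edge if the path has
        -- length 0.
        have : a = a' := by
          cases p with
          | nil => exact Eq.trans hp (Eq.symm hp')
          | cons e p => exact hp.1.symm.trans hp'.1
        subst this
        rfl
      simp [h, h']

/-! ### The map on matrices and on C(Γ/W) + I -/

variable (hW hW') in
/-- The linear map from the matrices to `L(Γ)` with `a_{x,y} ↦ x a y*`. -/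
def fromMat : (linking F hW hW').Mat →ₗ[F] Leavitt F Γ :=
  FinMat.extend fun i => leftWord hW hW' i.1 ∘ₗ rightWord hW hW' i.2 ∘ₗ
    (fromRestrict F hW : Leavitt F (Γ.restrict W) →ₗ[F] Leavitt F Γ)

theorem fromMat_unit (p q) (a : Leavitt F (Γ.restrict W)) :
    fromMat hW hW' (FinMat.unit p q a)
      = leftWord hW hW' p (rightWord hW hW' q (fromRestrict F hW a)) :=
  FinMat.extend_unit _ p q a

theorem fromMat_lact (c : Cohn F (Γ.quotient hW)) (m : (linking F hW hW').Mat) :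
    fromMat hW hW' ((linking F hW hW').lact c m) = fromQuotient F hW c * fromMat hW hW' m := by
  classical
  induction c using Cohn.induction generalizing m with
  | gen g =>
    rw [lact_of]
    induction m using FinMat.induction with
    | zero => simp only [map_zero, mul_zero]
    | add m m' h h' => simp only [map_add, mul_add, h, h']
    | unit p q a =>
      rw [FinMat.rowMap_unit, fromMat_unit, leftWord_rightWord, ← rightWord_mul,
        fromQuotient_of_mul_leftWord]
      split_ifs
      · simp only [map_zero]
      · rw [fromMat_unit, leftWord_rightWord]
  | zero => simp [lact_zero]
  | add a b ha hb => simp [lact_add, ha, hb, add_mul]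
  | mul a b ha hb => simp [lact_mul, ha, hb, mul_assoc]
  | smul t a ha => simp [lact_smul, ha, smul_mul_assoc]

theorem fromMat_ract (c : Cohn F (Γ.quotient hW)) (m : (linking F hW hW').Mat) :
    fromMat hW hW' ((linking F hW hW').ract c m) = fromMat hW hW' m * fromQuotient F hW c := by
  classical
  induction c using Cohn.induction generalizing m with
  | gen g =>
    rw [ract_of]
    induction m using FinMat.induction with
    | zero => simp only [map_zero, zero_mul]
    | add m m' h h' => simp only [map_add, add_mul, h, h']
    | unit p q a =>
      rw [FinMat.colMap_unit, fromMat_unit, ← leftWord_mul, rightWord_mul_fromQuotient_of]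
      split_ifs
      · simp only [map_zero]
      · rw [fromMat_unit]
  | zero => simp [ract_zero]
  | add a b ha hb => simp [ract_add, ha, hb, mul_add]
  | mul a b ha hb => simp [ract_mul, ha, hb, mul_assoc]
  | smul t a ha => simp [ract_smul, ha, mul_smul_comm]

/-- A corner condition on the left factor suffices, since r(y) arises to the right of its entries.
-/
theorem fromMat_mul {m : (linking F hW hW').Mat} (hm : m ∈ (linking F hW hW').cornerMat F)
    (n : (linking F hW hW').Mat) :
    fromMat hW hW' (m * n) = fromMat hW hW' m * fromMat hW hW' n := by
  classical
  -- Collecting the good left factors in a subspace allows reduction to single entries within I;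
  -- induction over arbitrary matrices would lose the corner condition.
  let N : Submodule F (linking F hW hW').Mat :=
    { carrier := {m | ∀ n, fromMat hW hW' (m * n) = fromMat hW hW' m * fromMat hW hW' n}
      add_mem' := fun h h' n => by rw [add_mul, map_add, map_add, h n, h' n, add_mul]
      zero_mem' := fun n => by rw [zero_mul, map_zero, zero_mul]
      smul_mem' := fun t m h n => by rw [smul_mul_assoc, map_smul, map_smul, h n, smul_mul_assoc] }
  refine le_of_units_mem (N := N) (fun p q a ha n => ?_) hm n
  induction n using FinMat.induction with
  | zero => simp only [map_zero, mul_zero]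
  | add n n' h h' => simp only [map_add, mul_add, h, h']
  | unit q' t b =>
    rw [FinMat.unit_mul_unit, fromMat_unit, fromMat_unit, leftWord_rightWord q', ← leftWord_mul,
      ← rightWord_mul, rightWord_mul_leftWord ha]
    split_ifs
    · rw [fromMat_unit]
    · simp only [map_zero]

variable (F hW hW') in
/-- The homomorphism from `C(Γ/W) + I` to `L(Γ)`. -/
def fromCohnCorner : cohnCorner F (linking F hW hW') →ₙₐ[F] Leavitt F Γ where
  toFun x := fromQuotient F hW x.1.cohn + fromMat hW hW' x.1.mat
  map_smul' t x := by
    change fromQuotient F hW (t • x.1.cohn) + fromMat hW hW' (t • x.1.mat) = _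
    rw [map_smul, map_smul, ← smul_add]
    rfl
  map_zero' := by
    change fromQuotient F hW 0 + fromMat hW hW' 0 = _
    rw [map_zero, map_zero, add_zero]
  map_add' x y := by
    change fromQuotient F hW (x.1.cohn + y.1.cohn) + fromMat hW hW' (x.1.mat + y.1.mat) = _
    rw [map_add, map_add]
    abel
  map_mul' x y := by
    change fromQuotient F hW (x.1.cohn * y.1.cohn) + fromMat hW hW' (x.1 * y.1).mat = _
    rw [CohnMat.mat_mul, map_add, map_add, map_mul, fromMat_lact, fromMat_ract, fromMat_mul x.2,
      add_mul, mul_add, mul_add]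
    abel

theorem fromCohnCorner_apply (x) : fromCohnCorner F hW hW' x
    = fromQuotient F hW x.1.cohn + fromMat hW hW' x.1.mat := rfl

/-- The matrix part of the relator maps to the sum of e r(e) e* = ee* over the connecting edges,
which is what the sum over Γ/W lacks compared with the Cuntz–Krieger relation of Γ. -/
theorem fromCohnCorner_CK {a : {a : V // a ∉ W}} (ha : ¬ (Γ.quotient hW).IsSink a) :
    fromCohnCorner F hW hW' (CK F (linking F hW hW') a) = 0 := by
  have L := Leavitt.isCohnFamily_of (F := F) (Γ := Γ)
  have h₁ : fromQuotient F hW (ck F (Γ.quotient hW) a) = Leavitt.of F Γ (.vert a.1)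
      - ∑ f ∈ (Γ.quotient hW).out a, Leavitt.of F Γ (.edge f.1) * Leavitt.of F Γ (.ghost f.1) := by
    simp only [ck, map_sub, map_sum, map_mul, fromQuotient_of, Gen.map]
  have h₂ : fromMat hW hW' ((linking F hW hW').ckMat a)
      = ∑ d ∈ (linking F hW hW').out a, Leavitt.of F Γ (.edge d.1) * Leavitt.of F Γ (.ghost d.1) := by
    rw [ckMat, map_sum]
    refine Finset.sum_congr rfl fun d _ => ?_
    rw [fromMat_unit, linking_idem, fromRestrict_of]
    change Leavitt.of F Γ (.edge d.1)
      * (Leavitt.of F Γ (.vert (Γ.r d.1)) * Leavitt.of F Γ (.ghost d.1)) = _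
    rw [L.range_ghost]
  have h := sum_out_quotient (fun f => Leavitt.of F Γ (.edge f) * Leavitt.of F Γ (.ghost f))
    F hW hW' a
  rw [← Leavitt.vert_eq_sum ((isSink_quotient hW hW' a).not.1 ha), ← h₂] at h
  rw [fromCohnCorner_apply]
  change fromQuotient F hW (ck F (Γ.quotient hW) a)
    + fromMat hW hW' (-(linking F hW hW').ckMat a) = 0
  rw [h₁, map_neg, ← h]
  abel

variable (F hW hW') in
/-- The homomorphism from the wreath product to the Leavitt path algebra. -/
def fromWreath : Wreath F (linking F hW hW') →ₙₐ[F] Leavitt F Γ :=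
  AlgQuot.lift _ (fromCohnCorner F hW hW') (by
    rintro _ ⟨a, ha, rfl⟩
    exact fromCohnCorner_CK ha)

/-- The case with content is a connecting edge: r(e)_{e,0} returns to e r(e) = e, and dually for e*.
-/
theorem fromCohnCorner_toCohnCorner (g : Gen V E) :
    fromCohnCorner F hW hW' (toCohnCorner F hW hW' g) = Leavitt.of F Γ g := by
  have L := Leavitt.isCohnFamily_of (F := F) (Γ := Γ)
  rw [fromCohnCorner_apply]
  rcases g with a | e | e
  · by_cases ha : a ∈ W
    · simp [toCohnCorner, toCohnMat, ha, fromMat_unit, leftWord, rightWord, fromRestrict_of, Gen.map]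
    · simp [toCohnCorner, toCohnMat, ha, fromQuotient_of, Gen.map]
  · by_cases hr : Γ.r e ∈ W
    · by_cases hs : Γ.s e ∈ W
      · simp [toCohnCorner, toCohnMat, hr, hs, fromMat_unit, leftWord, rightWord, fromRestrict_of,
          Gen.map]
      · simp [toCohnCorner, toCohnMat, hr, hs, fromMat_unit, leftWord, rightWord, fromRestrict_of,
          Gen.map, single, pathWord, L.mul_range]
    · simp [toCohnCorner, toCohnMat, hr, fromQuotient_of, Gen.map]
  · by_cases hr : Γ.r e ∈ W
    · by_cases hs : Γ.s e ∈ W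
      · simp [toCohnCorner, toCohnMat, hr, hs, fromMat_unit, leftWord, rightWord, fromRestrict_of,
          Gen.map]
      · simp [toCohnCorner, toCohnMat, hr, hs, fromMat_unit, leftWord, rightWord, fromRestrict_of,
          Gen.map, single, ghostWord, L.range_ghost]
    · simp [toCohnCorner, toCohnMat, hr, fromQuotient_of, Gen.map]

theorem fromWreath_toWreath (c : Leavitt F Γ) :
    fromWreath F hW hW' (toWreath F hW hW' c) = c := by
  induction c using Leavitt.induction with
  | gen g => rw [toWreath_of]; exact fromCohnCorner_toCohnCorner g
  | zero => simp only [map_zero]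
  | add a b ha hb => simp only [map_add, ha, hb]
  | mul a b ha hb => simp only [map_mul, ha, hb]
  | smul t a ha => simp only [map_smul, ha]

end FromWreath

end RFGraph

/-! ### Surjectivity -/

namespace RFGraph

section Surjectivity

variable {F : Type u} [Field F] {V : Type v} {E : Type w} {Γ : RFGraph V E} {W : Set V}
  {hW : Γ.Hereditary W} {hW' : Γ.Saturated W}

open Linking CohnMat

variable {R : NonUnitalSubalgebra F (CohnMat F (linking F hW hW'))}

/-- Here and below, `R` is any subalgebra containing the images of the generators of L(Γ); the aim
is that it contains C(Γ/W) + I. -/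
theorem inl_mem (hR : ∀ g, toCohnMat F hW hW' g ∈ R) (c : Cohn F (Γ.quotient hW)) :
    inl F (linking F hW hW') c ∈ R := by
  induction c using Cohn.induction with
  | gen g =>
    rcases g with a | e | e
    · have := hR (.vert a.1)
      simpa only [toCohnMat, a.2, dite_false] using this
    · have := hR (.edge e.1)
      simpa only [toCohnMat, e.2, dite_false] using this
    · have := hR (.ghost e.1)
      simpa only [toCohnMat, e.2, dite_false] using this
  | zero => rw [map_zero]; exact zero_mem R
  | add a b ha hb => rw [map_add]; exact add_mem ha hb
  | mul a b ha hb => rw [← inl_mul_inl]; exact mul_mem ha hb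
  | smul t a ha => rw [map_smul]; exact SMulMemClass.smul_mem t ha

theorem unit_none_none_mem (hR : ∀ g, toCohnMat F hW hW' g ∈ R) (a : Leavitt F (Γ.restrict W)) :
    inr F (linking F hW hW') (FinMat.unit none none a) ∈ R := by
  classical
  induction a using Leavitt.induction with
  | gen g =>
    rcases g with a | e | e
    · have := hR (.vert a.1)
      simpa only [toCohnMat, a.2, dite_true] using this
    · have := hR (.edge e.1)
      simpa only [toCohnMat, e.2.1, e.2.2, dite_true] using this
    · have := hR (.ghost e.1)
      simpa only [toCohnMat, e.2.1, e.2.2, dite_true] using this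
  | zero => rw [FinMat.unit_zero, map_zero]; exact zero_mem R
  | add a b ha hb => rw [FinMat.unit_add, map_add]; exact add_mem ha hb
  | mul a b ha hb =>
    have := mul_mem ha hb
    rwa [inr_mul_inr, FinMat.unit_mul_unit, if_pos rfl] at this
  | smul t a ha => rw [← FinMat.smul_unit, map_smul]; exact SMulMemClass.smul_mem t ha

/-- A connecting edge d itself maps to r(d)_{d,0}; left multiplication by edges of Γ/W then
lengthens the row index one edge at a time. -/
theorem unit_some_none_mem (hR : ∀ g, toCohnMat F hW hW' g ∈ R)
    (x : (linking F hW hW').LinkPath) : inr F (linking F hW hW')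
      (FinMat.unit (some x) none ((linking F hW hW').idem ((linking F hW hW').r x.last))) ∈ R := by
  classical
  obtain ⟨a, p, d, hp⟩ := x
  induction p generalizing a with
  | nil =>
    obtain rfl : a = (linking F hW hW').s d := hp
    have := hR (.edge d.1)
    simp only [toCohnMat, d.2.1, d.2.2, dite_true, dite_false] at this
    exact this
  | cons e p ih =>
    obtain ⟨rfl, hp⟩ := hp
    have := mul_mem (inl_mem hR (Cohn.of F _ (.edge e))) (ih _ hp)
    rw [inl_mul_inr, lact_of, FinMat.rowMap_unit] at this
    simpa [act] using this

theorem unit_none_some_mem (hR : ∀ g, toCohnMat F hW hW' g ∈ R)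
    (x : (linking F hW hW').LinkPath) : inr F (linking F hW hW')
      (FinMat.unit none (some x) ((linking F hW hW').idem ((linking F hW hW').r x.last))) ∈ R := by
  classical
  obtain ⟨a, p, d, hp⟩ := x
  induction p generalizing a with
  | nil =>
    obtain rfl : a = (linking F hW hW').s d := hp
    have := hR (.ghost d.1)
    simp only [toCohnMat, d.2.1, d.2.2, dite_true, dite_false] at this
    exact this
  | cons e p ih =>
    obtain ⟨rfl, hp⟩ := hp
    have := mul_mem (ih _ hp) (inl_mem hR (Cohn.of F _ (.ghost e)))
    rw [inr_mul_inl, ract_of, FinMat.colMap_unit] at this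
    simpa [act, genStar] using this

/-- For nonzero p and q, a_{p,q} = r(p)_{p,0} a_{0,0} r(q)_{0,q}, because a = r(p) a r(q). A factor
at an index `0` is omitted. -/
theorem unit_mem (hR : ∀ g, toCohnMat F hW hW' g ∈ R) {p q} {a : Leavitt F (Γ.restrict W)}
    (ha : a ∈ (linking F hW hW').corner F p q) :
    inr F (linking F hW hW') (FinMat.unit p q a) ∈ R := by
  classical
  have h := unit_none_none_mem hR a
  have hl : inr F (linking F hW hW') (FinMat.unit p none a) ∈ R := by
    cases p with
    | none => exact h
    | some x =>
      have := mul_mem (unit_some_none_mem hR x) h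
      rwa [inr_mul_inr, FinMat.unit_mul_unit, if_pos rfl, idem_mul_of_mem_corner ha] at this
  cases q with
  | none => exact hl
  | some y =>
    have := mul_mem hl (unit_none_some_mem hR y)
    rwa [inr_mul_inr, FinMat.unit_mul_unit, if_pos rfl, mul_idem_of_mem_corner ha] at this

theorem cohnCorner_le (hR : ∀ g, toCohnMat F hW hW' g ∈ R) :
    cohnCorner F (linking F hW hW') ≤ R := by
  intro x hx
  rw [eq_inl_add_inr x]
  exact add_mem (inl_mem hR _) (le_of_units_mem (N := R.toSubmodule.comap (inr F _))
    (fun p q a ha => unit_mem hR ha) hx)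

theorem toWreath_surjective : Function.Surjective (toWreath F hW hW') := by
  intro z
  obtain ⟨x, rfl⟩ := AlgQuot.mk_surjective _ z
  -- `S` is the preimage of the range in C(Γ/W) + I. It is then pushed forward into C(Γ/W) + M(A),
  -- where `cohnCorner_le` applies.
  let S : NonUnitalSubalgebra F (cohnCorner F (linking F hW hW')) :=
    (NonUnitalAlgHom.range (toWreath F hW hW')).comap (AlgQuot.mk _)
  have hR (g) : toCohnMat F hW hW' g ∈ S.map
      (NonUnitalSubalgebraClass.subtype (cohnCorner F (linking F hW hW'))) :=
    ⟨toCohnCorner F hW hW' g, ⟨Leavitt.of F Γ g, toWreath_of F hW hW' g⟩, rfl⟩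
  obtain ⟨y, hy, hyx⟩ := cohnCorner_le hR x.2
  obtain rfl : y = x := Subtype.ext hyx
  exact hy

end Surjectivity

end RFGraph

end

theorem proposition2 {F : Type*} [Field F] {V : Type*} {E : Type*} (Γ : RFGraph V E)
    (W : Set V) (hW : Γ.Hereditary W) (hW' : Γ.Saturated W) :
    ∃ φ : RFGraph.Leavitt F Γ →ₙₐ[F] RFGraph.Linking.Wreath F (RFGraph.linking F hW hW'),
      Function.Bijective φ :=
  ⟨RFGraph.toWreath F hW hW', Function.LeftInverse.injective RFGraph.fromWreath_toWreath,
    RFGraph.toWreath_surjective⟩
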